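/- Decision trees. Let $N\ge 1$. For $1\le n\le N$ let $\mathcal G_n$ be a finite rooted tree with $n$ leaves and ordered edges, each of whose $J_n$ inner nodes $j$ has $K_{nj}\ge 2$ outgoing edges. Let $\boldsymbol\alpha_n^{(j)}\in\mathbb N^{K_{nj}}$ list the numbers of leaves spanned by the edges leaving $j$. The output rail of a leaf is that leaf, and the output rail of a larger tree is the output rail of the subtree at the last edge of its root. The leaves (input rails) and the output rails are labelled by two bijections with $\{1,\dots,n\}$, such that the output rail of $\mathcal G_n$ gets the label $n$ among the outputs; otherwise the labels are arbitrary. Rotation operators. For every $K=K_{nj}$ that occurs let $O_K(\boldsymbol x)$ be any measurable family of real matrices such that, for all $\boldsymbol x$ in the probability simplex $\Delta_K=\{\boldsymbol x\in\mathbb R_{\ge0}^K:\sum_k x_k=1\}$, $O_K(\boldsymbol x)$ is orthogonal and $O_K(\boldsymbol x)\sqrt{\boldsymbol x}=\boldsymbol e_K$ (entrywise square root). Given node parameters $\boldsymbol x_n^{(j)}$, the tree operator $O_{n,\mathcal G_n}$ is defined recursively: it is $1$ for a single leaf, and otherwise the direct sum of the operators of the subtrees at the root $j$, followed by $O_{K_{nj}}(\boldsymbol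 x_n^{(j)})$ acting on the output rails of these subtrees. Put $R_{n,\mathcal G_n}=O_{n,\mathcal G_n}\,\mathrm{diag}(e^{-i\varphi_{n1}},\dots,e^{-i\varphi_{nn}})$, let $R^{[N]}_{n,\mathcal G_n}$ be this matrix acting on the first $n$ coordinates of $\mathbb C^N$ (the identity on the others), and let $$U_N=R^{[N]}_{1,\mathcal G_1}R^{[N]}_{2,\mathcal G_2}\cdots R^{[N]}_{N,\mathcal G_N}.$$ General trees. As the phases run over $[0,2\pi)$ and each $\boldsymbol x_n^{(j)}$ over $\Delta_{K_{nj}}$, the matrices $U_N$ are exactly the elements of $\mathrm U(N)$, and the parameters are determined by $U_N$ where all $x^{(j)}_{n,k}>0$. The normalized Haar measure $\mu$ of $\mathrm U(N)$ is the image under the cascade of a product of uniform phases and Dirichlet distributions (under which almost surely all $x_{n,k}^{(j)}>0$): $$\mathrm d\mu(U_N)=\prod_{n=1}^N\frac{\mathrm d\boldsymbol\varphi_n}{(2\pi)^n}\prod_{j=1}^{J_n}\mathcal P_{\mathrm D}(\boldsymbol x_n^{(j)};\boldsymbol\alpha_n^{(j)})\,\mathrm d\boldsymbol x_n^{(j)},\qquad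 \mathcal P_{\mathrm D}(\boldsymbol x;\boldsymbol\alpha)=\frac{\Gamma(\sum_k\alpha_k)}{\prod_k\Gamma(\alpha_k)}\prod_{k=1}^K x_k^{\alpha_k-1},$$ where $\mathrm d\boldsymbol x=\mathrm dx_1\cdots\mathrm dx_{K-1}$ and $x_K=1-\sum_{k<K}x_k$. Binary trees. Suppose that all $K_{nj}=2$; then $J_n=n-1$. Write $\boldsymbol x_n^{(j)}=(t_{nj},1-t_{nj})$, $\boldsymbol\alpha_n^{(j)}=(\alpha_{nj},\beta_{nj})$, $t_{nj}=\cos^2(\theta_{nj}/2)$ with $\theta_{nj}\in[0,\pi]$, and $\xi_{nj}=I_{t_{nj}}(\alpha_{nj},\beta_{nj})$ (the regularized incomplete beta function, a bijection of $[0,1]$ in $t_{nj}$). In the same sense $$\mathrm d\mu(U_N)=\prod_{n=1}^N\frac{\mathrm d\boldsymbol\varphi_n}{(2\pi)^n}\prod_{j=1}^{n-1}\frac{t_{nj}^{\alpha_{nj}-1}(1-t_{nj})^{\beta_{nj}-1}}{B(\alpha_{nj},\beta_{nj})}\,\mathrm dt_{nj} =\prod_{n=1}^N\frac{\mathrm d\boldsymbol\varphi_n}{(2\pi)^n}\prod_{j=1}^{n-1}\frac{(\cos\frac{\theta_{nj}}2)^{2\alpha_{nj}-1}(\sin\frac{\theta_{nj}}2)^{2\beta_{nj}-1}}{B(\alpha_{nj},\beta_{nj})}\,\mathrm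 d\theta_{nj} =\prod_{n=1}^N\frac{\mathrm d\boldsymbol\varphi_n}{(2\pi)^n}\prod_{j=1}^{n-1}\mathrm d\xi_{nj},$$ with $B(\alpha,\beta)=\Gamma(\alpha)\Gamma(\beta)/\Gamma(\alpha+\beta)$. The Haar phases $\xi_{nj}$ of beta distributed $t_{nj}$ are independent and uniform on $[0,1]$. Moreover, for any random phases in $[0,2\pi)$ and $t_{nj}\in(0,1)$ with an arbitrary joint distribution, $U_N$ is Haar distributed if and only if all $\varphi_{nm}$ and $\xi_{nj}$ are independent, the phases uniform on $[0,2\pi)$ and the Haar phases uniform on $[0,1]$. Unbalanced trees. If $\mathcal G_n$ is the maximally unbalanced binary tree (the last edge of every node leads to a leaf, and the first edge to the rest of the tree), then its nodes can be numbered $j=1,\dots,n-1$ so that $\alpha_{nj}=j$ and $\beta_{nj}=1$, and $\xi_{nj}=I_{t_{nj}}(j,1)=t_{nj}^{\,j}$. -/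

import Mathlib

open MeasureTheory
open scoped ENNReal

noncomputable section

namespace TreeHaar

/-! ### The unitary group as a compact Borel group -/

/-- Matrices carry the product (equivalently Borel) sigma-algebra. -/
instance matrixMeasurableSpace {m n R : Type*} [MeasurableSpace R] :
    MeasurableSpace (Matrix m n R) :=
  inferInstanceAs (MeasurableSpace (m → n → R))

instance matrixBorelSpace {N : ℕ} : BorelSpace (Matrix (Fin N) (Fin N) ℂ) :=
  inferInstanceAs (BorelSpace (Fin N → Fin N → ℂ))

instance unitaryCompactSpace {N : ℕ} : CompactSpace (Matrix.unitaryGroup (Fin N) ℂ) := by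
  have hK : IsCompact (Set.univ.pi fun _ : Fin N => Set.univ.pi fun _ : Fin N =>
      Metric.closedBall (0 : ℂ) 1) :=
    isCompact_univ_pi fun _ => isCompact_univ_pi fun _ => isCompact_closedBall _ _
  have hcl : IsClosed {U : Matrix (Fin N) (Fin N) ℂ | U ∈ Matrix.unitaryGroup (Fin N) ℂ} :=
    isClosed_unitary
  refine isCompact_iff_compactSpace.mp (hK.of_isClosed_subset hcl ?_)
  intro U hU i _ j _
  simpa using entry_norm_bound_of_unitary hU i j

/-- The normalized Haar measure of `U(N)`. -/
def haarU (N : ℕ) : Measure (Matrix.unitaryGroup (Fin N) ℂ) :=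
  Measure.haarMeasure ⊤

/-- The law, as a matrix, of a Haar distributed element of `U(N)`. -/
def haarMatrixLaw (N : ℕ) : Measure (Matrix (Fin N) (Fin N) ℂ) :=
  (haarU N).map Subtype.val

/-! ### Decision trees -/

/-- Finite rooted trees with ordered outgoing edges. Every node has `k + 2 ≥ 2` outgoing edges. -/
inductive DTree : Type
  | leaf : DTree
  | node (k : ℕ) (c : Fin (k + 2) → DTree) : DTree

namespace DTree

/-- The leaves of a tree. -/
@[reducible] def Leaf : DTree → Type
  | leaf => Unit
  | node _ c => Σ i, Leaf (c i)

/-- The (inner, decision) nodes of a tree. -/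
@[reducible] def Node : DTree → Type
  | leaf => Empty
  | node _ c => Unit ⊕ (Σ i, Node (c i))

instance leafDecidableEq : (t : DTree) → DecidableEq (Leaf t)
  | leaf => inferInstanceAs (DecidableEq Unit)
  | node _ c =>
    haveI := fun i => leafDecidableEq (c i)
    inferInstanceAs (DecidableEq (Σ i, Leaf (c i)))

instance leafFintype : (t : DTree) → Fintype (Leaf t)
  | leaf => inferInstanceAs (Fintype Unit)
  | node _ c =>
    haveI := fun i => leafFintype (c i)
    inferInstanceAs (Fintype (Σ i, Leaf (c i)))

instance nodeFintype : (t : DTree) → Fintype (Node t)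
  | leaf => inferInstanceAs (Fintype Empty)
  | node _ c =>
    haveI := fun i => nodeFintype (c i)
    inferInstanceAs (Fintype (Unit ⊕ (Σ i, Node (c i))))

/-- A node `j` has `K_j = extra j + 2` outgoing edges. -/
@[reducible] def extra : (t : DTree) → Node t → ℕ
  | leaf, j => Empty.elim j
  | node k _, Sum.inl _ => k
  | node _ c, Sum.inr ⟨i, j⟩ => extra (c i) j

/-- `weight t j k` is the number of leaves spanned by the `k`-th edge leaving the node `j`. -/
def weight : (t : DTree) → (j : Node t) → Fin (extra t j + 2) → ℕ
  | leaf, j => Empty.elim j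
  | node _ c, Sum.inl _ => fun i => Fintype.card (Leaf (c i))
  | node _ c, Sum.inr ⟨i, j⟩ => weight (c i) j

/-- All nodes have exactly two outgoing edges. -/
def IsBinary (t : DTree) : Prop := ∀ j : Node t, extra t j = 0

/-- The output rail of a tree, obtained by following last edges from the root. -/
def out : (t : DTree) → Leaf t
  | leaf => ()
  | node k c => ⟨Fin.last (k + 1), out (c (Fin.last (k + 1)))⟩

/-- The output rails of the subtrees hanging at the root of `node k c`. -/
def outs {k : ℕ} (c : Fin (k + 2) → DTree) : Fin (k + 2) ↪ Leaf (node k c) :=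
  ⟨fun i => ⟨i, out (c i)⟩, fun _ _ h => congrArg Sigma.fst h⟩

/-- The maximally unbalanced binary tree with `m` nodes and `m + 1` leaves. -/
def chain : ℕ → DTree
  | 0 => leaf
  | m + 1 => node 0 ![chain m, leaf]

end DTree

/-- A tree with `n = m + 1` leaves whose leaves (input rails) and whose output rails are labelled by
`Fin n`, where the output rail of the whole tree is the last one. -/
structure LabelledTree (m : ℕ) where
  /-- the underlying tree -/
  tree : DTree
  /-- the labels of the input rails -/
  input : tree.Leaf ≃ Fin (m + 1)
  /-- the labels of the output rails -/
  output : tree.Leaf ≃ Fin (m + 1)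
  /-- the output rail of the tree is the last rail -/
  output_out : output tree.out = Fin.last m

/-! ### Rotation operators and cascades -/

/-- The embedding of a matrix `A` along an injection `f` of index sets: `A` acts on the coordinates
in the range of `f`, and the identity on the others. -/
def embed {ι κ R : Type*} [Fintype ι] [DecidableEq ι] [DecidableEq κ] [CommRing R]
    (f : ι ↪ κ) (A : Matrix ι ι R) : Matrix κ κ R :=
  1 + (Matrix.of fun i a => if i = f a then 1 else 0 : Matrix κ ι R) * (A - 1) *
    (Matrix.of fun a i => if i = f a then 1 else 0 : Matrix ι κ R)

theorem embed_apply_range {ι κ R : Type*} [Fintype ι] [DecidableEq ι] [DecidableEq κ] [CommRing R]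
    (f : ι ↪ κ) (A : Matrix ι ι R) (a b : ι) : embed f A (f a) (f b) = A a b := by
  simp [embed, Matrix.mul_apply, Matrix.one_apply]

theorem embed_apply_left {ι κ R : Type*} [Fintype ι] [DecidableEq ι] [DecidableEq κ] [CommRing R]
    (f : ι ↪ κ) (A : Matrix ι ι R) (i j : κ) (hi : ∀ a, i ≠ f a) :
    embed f A i j = if i = j then 1 else 0 := by
  simp [embed, Matrix.mul_apply, Matrix.one_apply, hi]

theorem embed_apply_right {ι κ R : Type*} [Fintype ι] [DecidableEq ι] [DecidableEq κ] [CommRing R]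
    (f : ι ↪ κ) (A : Matrix ι ι R) (i j : κ) (hj : ∀ a, j ≠ f a) :
    embed f A i j = if i = j then 1 else 0 := by
  simp [embed, Matrix.mul_apply, Matrix.one_apply, hj]

/-- A Dirichlet node operator: a measurable family of real orthogonal matrices, indexed by the
probability simplex, with `O(x) √x = e_K`, where `K = m + 1`. -/
structure IsNodeOperator {m : ℕ}
    (O : (Fin (m + 1) → ℝ) → Matrix (Fin (m + 1)) (Fin (m + 1)) ℝ) : Prop where
  measurable : Measurable O
  orthogonal : ∀ x ∈ stdSimplex ℝ (Fin (m + 1)), O x ∈ Matrix.orthogonalGroup (Fin (m + 1)) ℝ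
  mulVec_sqrt : ∀ x ∈ stdSimplex ℝ (Fin (m + 1)),
    (O x).mulVec (fun k => √(x k)) = Pi.single (Fin.last m) 1

/-- The tree operator assembled from one matrix per node: the operators of the subtrees act in
parallel, and then the matrix of the root acts on the output rails of the subtrees. -/
def treeOperator : (t : DTree) →
    ((j : t.Node) → Matrix (Fin (t.extra j + 2)) (Fin (t.extra j + 2)) ℝ) →
    Matrix t.Leaf t.Leaf ℝ
  | .leaf, _ => 1
  | .node _ c, A =>
    embed (DTree.outs c) (A (Sum.inl ())) *
      Matrix.blockDiagonal' fun i => treeOperator (c i) fun j => A (Sum.inr ⟨i, j⟩)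

/-- The rotation operator `R = O(x) D(-φ)` of a labelled tree, as an `n × n` matrix, `n = m + 1`. -/
def rotation {m : ℕ} (G : LabelledTree m)
    (O : (K : ℕ) → (Fin K → ℝ) → Matrix (Fin K) (Fin K) ℝ)
    (φ : Fin (m + 1) → ℝ) (x : (j : G.tree.Node) → Fin (G.tree.extra j + 2) → ℝ) :
    Matrix (Fin (m + 1)) (Fin (m + 1)) ℂ :=
  ((treeOperator G.tree fun j => O _ (x j)).reindex G.output G.input).map Complex.ofReal *
    Matrix.diagonal fun i => Complex.exp (-(φ i * Complex.I))

/-- The parameters of a cascade: the index `n : Fin N` stands for the tree with `n + 1` leaves, with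
`n + 1` phases and one vector of length `K_j` for each node `j`. -/
abbrev Params {N : ℕ} (G : (n : Fin N) → LabelledTree n.val) : Type :=
  (n : Fin N) → (Fin (n.val + 1) → ℝ) ×
    ((j : (G n).tree.Node) → Fin ((G n).tree.extra j + 2) → ℝ)

/-- The cascade `U = R_1 R_2 ⋯ R_N`, each `R_n` acting on the first `n` of the `N` coordinates. -/
def cascade {N : ℕ} (G : (n : Fin N) → LabelledTree n.val)
    (O : (K : ℕ) → (Fin K → ℝ) → Matrix (Fin K) (Fin K) ℝ) (p : Params G) :
    Matrix (Fin N) (Fin N) ℂ :=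
  (List.ofFn fun n : Fin N =>
    embed (Fin.castLEEmb n.isLt) (rotation (G n) O (p n).1 (p n).2)).prod

/-- All phases in `[0, 2π)` and all node parameters in the probability simplex. -/
def admissible {N : ℕ} (G : (n : Fin N) → LabelledTree n.val) : Set (Params G) :=
  {p | ∀ n, (∀ m, (p n).1 m ∈ Set.Ico 0 (2 * Real.pi)) ∧
    ∀ j, (p n).2 j ∈ stdSimplex ℝ (Fin ((G n).tree.extra j + 2))}

/-- Admissible parameters with all the coordinates of the node parameters positive. -/
def regular {N : ℕ} (G : (n : Fin N) → LabelledTree n.val) : Set (Params G) :=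
  {p | p ∈ admissible G ∧ ∀ n j k, 0 < (p n).2 j k}

/-! ### Distributions of the parameters -/

/-- The uniform distribution `dφ / 2π` on `[0, 2π)`. -/
def phaseMeasure : Measure ℝ :=
  ENNReal.ofReal (1 / (2 * Real.pi)) • volume.restrict (Set.Ico 0 (2 * Real.pi))

/-- The Dirichlet density `Γ(∑ α_k) / ∏ Γ(α_k) * ∏ x_k ^ (α_k - 1)`. -/
def dirichletPDF {K : ℕ} (α x : Fin K → ℝ) : ℝ :=
  Real.Gamma (∑ k, α k) / (∏ k, Real.Gamma (α k)) * ∏ k, x k ^ (α k - 1)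

/-- Completes `(x_1, …, x_{K-1})` by `x_K = 1 - ∑_{k < K} x_k`. -/
def completeSimplex {m : ℕ} (x : Fin m → ℝ) : Fin (m + 1) → ℝ :=
  Fin.snoc (α := fun _ => ℝ) x (1 - ∑ i, x i)

/-- The Dirichlet distribution `P_D(x; α) dx_1 ⋯ dx_{K-1}` with `x_K = 1 - ∑_{k < K} x_k`, where
`K = m + 1`. -/
def dirichletMeasure {m : ℕ} (α : Fin (m + 1) → ℝ) : Measure (Fin (m + 1) → ℝ) :=
  (((volume : Measure (Fin m → ℝ)).restrict {x | (∀ i, 0 < x i) ∧ ∑ i, x i < 1}).withDensity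
    fun x => ENNReal.ofReal (dirichletPDF α (completeSimplex x))).map completeSimplex

/-- The measure of one rotation operator: uniform phases times the Dirichlet distributions of the
nodes, whose parameters are the numbers of leaves spanned by the outgoing edges. -/
def rotationMeasure {m : ℕ} (G : LabelledTree m) :
    Measure ((Fin (m + 1) → ℝ) × ((j : G.tree.Node) → Fin (G.tree.extra j + 2) → ℝ)) :=
  (Measure.pi fun _ => phaseMeasure).prod
    (Measure.pi fun j => dirichletMeasure fun k => (G.tree.weight j k : ℝ))

/-- The product over all rotation operators. -/
def paramMeasure {N : ℕ} (G : (n : Fin N) → LabelledTree n.val) : Measure (Params G) :=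
  Measure.pi fun n => rotationMeasure (G n)

/-! ### Binary trees -/

/-- Phases and one real parameter per node. -/
abbrev BinParams {N : ℕ} (G : (n : Fin N) → LabelledTree n.val) : Type :=
  (n : Fin N) → (Fin (n.val + 1) → ℝ) × ((G n).tree.Node → ℝ)

/-- The node parameters `(t, 1 - t)` of a binary tree with transmissivities `t`. -/
def ofTransmissivity {N : ℕ} (G : (n : Fin N) → LabelledTree n.val) (q : BinParams G) :
    Params G :=
  fun n => ((q n).1, fun j k => if k = 0 then (q n).2 j else 1 - (q n).2 j)

/-- Applies a function to the parameter of each node and keeps the phases. -/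
def mapNodes {N : ℕ} {G : (n : Fin N) → LabelledTree n.val}
    (f : (n : Fin N) → (G n).tree.Node → ℝ → ℝ) (q : BinParams G) : BinParams G :=
  fun n => ((q n).1, fun j => f n j ((q n).2 j))

/-- Uniform phases, and the distribution `ν n j` for the parameter of the node `j` of the tree `n`,
all independent. -/
def binMeasure {N : ℕ} (G : (n : Fin N) → LabelledTree n.val)
    (ν : (n : Fin N) → (G n).tree.Node → Measure ℝ) : Measure (BinParams G) :=
  Measure.pi fun n => (Measure.pi fun _ => phaseMeasure).prod (Measure.pi (ν n))

/-- All phases in `[0, 2π)` and all transmissivities in `(0, 1)`. -/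
def binRegular {N : ℕ} (G : (n : Fin N) → LabelledTree n.val) : Set (BinParams G) :=
  {q | ∀ n, (∀ m, (q n).1 m ∈ Set.Ico 0 (2 * Real.pi)) ∧ ∀ j, (q n).2 j ∈ Set.Ioo (0 : ℝ) 1}

/-- The number `α` of leaves spanned by the first edge of the node `j`. -/
def alpha {m : ℕ} (G : LabelledTree m) (j : G.tree.Node) : ℝ :=
  (G.tree.weight j 0 : ℝ)

/-- The number `β` of leaves spanned by the last edge of the node `j`. -/
def beta {m : ℕ} (G : LabelledTree m) (j : G.tree.Node) : ℝ :=
  (G.tree.weight j (Fin.last _) : ℝ)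

/-- The distribution on `(0, π)` with density
`cos (θ / 2) ^ (2 a - 1) * sin (θ / 2) ^ (2 b - 1) / B(a, b)`. -/
def phaseBetaMeasure (a b : ℝ) : Measure ℝ :=
  (volume.restrict (Set.Ioo 0 Real.pi)).withDensity fun θ =>
    ENNReal.ofReal (Real.cos (θ / 2) ^ (2 * a - 1) * Real.sin (θ / 2) ^ (2 * b - 1) /
      ProbabilityTheory.beta a b)

/-- The regularized incomplete beta function `I_t(a, b)`. -/
def regBeta (a b t : ℝ) : ℝ :=
  (∫ u in (0 : ℝ)..t, u ^ (a - 1) * (1 - u) ^ (b - 1)) / ProbabilityTheory.beta a b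

/-- The inverse on `[0, 1]` of `t ↦ I_t(a, b)`. -/
def regBetaInv (a b : ℝ) : ℝ → ℝ :=
  Function.invFunOn (regBeta a b) (Set.Icc 0 1)

end TreeHaar

end

namespace TreeHaar

/-! ### Embeddings of matrices -/

section Embed

variable {ι κ τ R : Type*} [Fintype ι] [DecidableEq ι] [DecidableEq κ] [DecidableEq τ] [CommRing R]

/-! Everything is read off the last row. Transposing `O x √x = e_K` shows that the last row of an
orthogonal node operator is `√x`. Hence the output row of a tree operator consists of the square
roots of the products of node parameters along the paths to the leaves (`treeOperator_out`), and the
phases turn it into `rowVec`. In `U_N = (U_{N-1} ⊕ 1) R_N` the first factor does not touch the last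
row, so the last row of `U_N` is that of `R_N`, whatever the other rows of the node operators are.
Every unit vector is such a row, with unique parameters as long as these are positive, and a unitary
matrix with the same last row as `R_N` differs from it by a left factor `V ⊕ 1`. Induction on `N`
gives surjectivity and injectivity.

For the measure, an independent Gamma(∑ α) variable times a Dirichlet(α) vector is a vector of
independent Gamma(α_k) variables (`gamma_prod_dirichlet`). Since the Dirichlet parameters are leaf
counts, this iterates down the tree: a Gamma(n) variable splits at the root into Gamma(n_i)
variables, one per subtree, and ends as `n` independent exponential variables on the leaves
(`gamma_prod_nodesMeasure`). Their square roots with independent uniform phases are complex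
Gaussians. So the last row is distributed like a normalised Gaussian vector, and its law is
invariant under unitary matrices (`rowLaw_vecMul`). This invariance suffices (`haarU_succ`): if `V`
is Haar distributed in `U(N)`, the mean of `f ((V ⊕ 1) M)` depends on `M` only through its last row,
so the law of `M` may be replaced by the Haar measure of `U(N + 1)`, which absorbs `V ⊕ 1`.

For binary trees a Dirichlet distribution is a beta distribution, and the other forms are
one-dimensional substitutions at each node, the incomplete beta function being the distribution
function. The converse holds because the cascade is injective on a measurable set that carries both
laws: by Lusin–Souslin, the image law then determines the law of the parameters
(`measure_eq_of_map_eq_of_injOn`). -/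

theorem embed_ext {f : ι ↪ κ} {A : Matrix ι ι R} {B : Matrix κ κ R}
    (h1 : ∀ a b, B (f a) (f b) = A a b)
    (h2 : ∀ i j, (∀ a, i ≠ f a) → B i j = if i = j then 1 else 0)
    (h3 : ∀ i j, (∀ a, j ≠ f a) → B i j = if i = j then 1 else 0) : embed f A = B := by
  ext i j
  by_cases hi : ∃ a, i = f a
  · obtain ⟨a, rfl⟩ := hi
    by_cases hj : ∃ b, j = f b
    · obtain ⟨b, rfl⟩ := hj
      rw [embed_apply_range, h1]
    · push Not at hj
      rw [embed_apply_right _ _ _ _ hj, h3 _ _ hj]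
  · push Not at hi
    rw [embed_apply_left _ _ _ _ hi, h2 _ _ hi]

theorem embed_one (f : ι ↪ κ) : embed f (1 : Matrix ι ι R) = 1 := by
  simp [embed]

theorem embed_injective (f : ι ↪ κ) : Function.Injective (embed f : Matrix ι ι R → _) := by
  intro A B h
  ext a b
  rw [← embed_apply_range f A, h, embed_apply_range]

theorem measurable_embed [MeasurableSpace R] [MeasurableAdd₂ R] [MeasurableMul₂ R] [MeasurableSub₂ R]
    (f : ι ↪ κ) : Measurable (embed f : Matrix ι ι R → Matrix κ κ R) := by
  refine measurable_pi_iff.2 fun i => measurable_pi_iff.2 fun j => ?_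
  by_cases hi : ∃ a, i = f a
  · obtain ⟨a, rfl⟩ := hi
    by_cases hj : ∃ b, j = f b
    · obtain ⟨b, rfl⟩ := hj
      simp only [embed_apply_range]
      exact (measurable_pi_apply b).comp (measurable_pi_apply a)
    · push Not at hj
      simp only [embed_apply_right _ _ _ _ hj]
      exact measurable_const
  · push Not at hi
    simp only [embed_apply_left _ _ _ _ hi]
    exact measurable_const

theorem embed_star [StarRing R] (f : ι ↪ κ) (A : Matrix ι ι R) :
    star (embed f A) = embed f (star A) := by
  symm
  refine embed_ext ?_ ?_ ?_
  · intro a b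
    simp [embed_apply_range]
  · intro i j hi
    rw [Matrix.star_apply, embed_apply_right _ _ _ _ hi]
    simp [eq_comm, apply_ite star]
  · intro i j hj
    rw [Matrix.star_apply, embed_apply_left _ _ _ _ hj]
    simp [eq_comm, apply_ite star]

variable [Fintype κ]

/-- A row in the range of `f` vanishes off that range, so the sum over `κ` collapses to a sum over
`ι`. -/
theorem embed_sum_left (f : ι ↪ κ) (A : Matrix ι ι R) (a : ι) (g : κ → R) :
    ∑ j, embed f A (f a) j * g j = ∑ b, A a b * g (f b) := by
  classical
  rw [← Finset.sum_subset (Finset.subset_univ (Finset.univ.map f))]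
  · simp [embed_apply_range]
  · intro j _ hj
    have hj' : ∀ b, j ≠ f b := fun b hb => hj (by simp [hb])
    rw [embed_apply_right _ _ _ _ hj', if_neg (fun h => hj' a h.symm), zero_mul]

theorem embed_sum_left' (f : ι ↪ κ) (A : Matrix ι ι R) (i : κ) (hi : ∀ a, i ≠ f a) (g : κ → R) :
    ∑ j, embed f A i j * g j = g i := by
  simp [embed_apply_left _ _ _ _ hi]

theorem embed_mul (f : ι ↪ κ) (A B : Matrix ι ι R) :
    embed f (A * B) = embed f A * embed f B := by
  refine embed_ext ?_ ?_ ?_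
  · intro a b
    rw [Matrix.mul_apply, embed_sum_left, Matrix.mul_apply]
    simp [embed_apply_range]
  · intro i j hi
    rw [Matrix.mul_apply, embed_sum_left' _ _ _ hi, embed_apply_left _ _ _ _ hi]
  · intro i j hj
    rw [Matrix.mul_apply]
    simp only [embed_apply_right _ _ _ _ hj]
    simp only [mul_ite, mul_one, mul_zero, Finset.sum_ite_eq', Finset.mem_univ, if_true]
    rw [embed_apply_right _ _ _ _ hj]

theorem embed_mem_unitary [StarRing R] (f : ι ↪ κ) {A : Matrix ι ι R}
    (hA : A ∈ Matrix.unitaryGroup ι R) : embed f A ∈ Matrix.unitaryGroup κ R := by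
  rw [Matrix.mem_unitaryGroup_iff] at hA ⊢
  rw [embed_star, ← embed_mul, hA, embed_one]

theorem embed_embed (f : ι ↪ κ) (g : κ ↪ τ) (A : Matrix ι ι R) :
    embed g (embed f A) = embed (f.trans g) A := by
  symm
  refine embed_ext ?_ ?_ ?_
  · intro a b
    simp [embed_apply_range]
  · intro i j hi
    by_cases h : ∃ c, i = g c
    · obtain ⟨c, rfl⟩ := h
      have hc : ∀ a, c ≠ f a := fun a ha => hi a (by simp [ha])
      by_cases hj : ∃ d, j = g d
      · obtain ⟨d, rfl⟩ := hj
        rw [embed_apply_range, embed_apply_left _ _ _ _ hc]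
        simp
      · push Not at hj
        rw [embed_apply_right _ _ _ _ hj]
    · push Not at h
      rw [embed_apply_left _ _ _ _ h]
  · intro i j hj
    by_cases h : ∃ c, j = g c
    · obtain ⟨c, rfl⟩ := h
      have hc : ∀ a, c ≠ f a := fun a ha => hj a (by simp [ha])
      by_cases hi : ∃ d, i = g d
      · obtain ⟨d, rfl⟩ := hi
        rw [embed_apply_range, embed_apply_right _ _ _ _ hc]
        simp
      · push Not at hi
        rw [embed_apply_left _ _ _ _ hi]
    · push Not at h
      rw [embed_apply_right _ _ _ _ h]

theorem embed_refl (f : ι ↪ ι) (hf : ∀ a, f a = a) (A : Matrix ι ι R) : embed f A = A := by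
  ext a b
  simpa [hf] using embed_apply_range f A a b

/-- `embed` along `f` as a monoid homomorphism. -/
def embedHom (f : ι ↪ κ) : Matrix ι ι R →* Matrix κ κ R where
  toFun := embed f
  map_one' := embed_one f
  map_mul' := embed_mul f

end Embed

theorem measurable_matrix_mul {α l m n R : Type*} [Fintype m] [CommRing R] [MeasurableSpace R]
    [MeasurableAdd₂ R] [MeasurableMul₂ R] [MeasurableSpace α] {A : α → Matrix l m R}
    {B : α → Matrix m n R} (hA : Measurable A) (hB : Measurable B) :
    Measurable fun x => A x * B x := by
  refine measurable_pi_iff.2 fun i => measurable_pi_iff.2 fun j => ?_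
  simp only [Matrix.mul_apply]
  refine Finset.measurable_sum _ fun k _ => ?_
  exact ((measurable_pi_iff.1 ((measurable_pi_iff.1 hA) i)) k).mul
    ((measurable_pi_iff.1 ((measurable_pi_iff.1 hB) k)) j)

theorem measurable_matrix_apply {α m n R : Type*} [MeasurableSpace R] [MeasurableSpace α]
    {A : α → Matrix m n R} (hA : Measurable A) (i : m) (j : n) : Measurable fun x => A x i j :=
  (measurable_pi_iff.1 ((measurable_pi_iff.1 hA) i)) j

/-! ### Probabilities of the leaves -/

/-- The product of the node parameters along the path from the root to a leaf. -/
def leafProb : (t : DTree) → ((j : t.Node) → Fin (t.extra j + 2) → ℝ) → t.Leaf → ℝ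
  | .leaf, _, _ => 1
  | .node _ c, x, ⟨i, l⟩ => x (Sum.inl ()) i * leafProb (c i) (fun j => x (Sum.inr ⟨i, j⟩)) l

theorem leafProb_nonneg (t : DTree) (x : (j : t.Node) → Fin (t.extra j + 2) → ℝ)
    (hx : ∀ j k, 0 ≤ x j k) (l : t.Leaf) : 0 ≤ leafProb t x l := by
  induction t with
  | leaf => exact zero_le_one
  | node k c ih =>
    obtain ⟨i, l⟩ := l
    exact mul_nonneg (hx (Sum.inl ()) i) (ih i _ (fun j => hx (Sum.inr ⟨i, j⟩)) l)

theorem leafProb_pos (t : DTree) (x : (j : t.Node) → Fin (t.extra j + 2) → ℝ)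
    (hx : ∀ j k, 0 < x j k) (l : t.Leaf) : 0 < leafProb t x l := by
  induction t with
  | leaf => exact zero_lt_one
  | node k c ih =>
    obtain ⟨i, l⟩ := l
    exact mul_pos (hx (Sum.inl ()) i) (ih i _ (fun j => hx (Sum.inr ⟨i, j⟩)) l)

theorem sum_leafProb (t : DTree) (x : (j : t.Node) → Fin (t.extra j + 2) → ℝ)
    (hx : ∀ j, ∑ k, x j k = 1) : ∑ l, leafProb t x l = 1 := by
  induction t with
  | leaf =>
    change ∑ l : Unit, (1 : ℝ) = 1
    simp
  | node k c ih =>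
    change ∑ l : Σ i, (c i).Leaf, leafProb (.node k c) x l = 1
    rw [Fintype.sum_sigma]
    simp only [leafProb, ← Finset.mul_sum]
    refine (Finset.sum_congr rfl fun i _ => ?_).trans (hx (Sum.inl ()))
    rw [ih i _ fun j => hx (Sum.inr ⟨i, j⟩), mul_one]

theorem measurable_childParams {k : ℕ} (c : Fin (k + 2) → DTree)
    {X : (DTree.node k c).Node → Type*} [∀ j, MeasurableSpace (X j)] (i : Fin (k + 2)) :
    Measurable fun (x : ∀ j, X j) (j : (c i).Node) => x (Sum.inr ⟨i, j⟩) :=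
  measurable_pi_iff.2 fun _ => measurable_pi_apply _

theorem measurable_leafProb (t : DTree) (l : t.Leaf) : Measurable fun x => leafProb t x l := by
  induction t with
  | leaf => exact measurable_const
  | node k c ih =>
    obtain ⟨i, l⟩ := l
    refine Measurable.mul (by fun_prop) ((ih i l).comp (measurable_childParams c i))

/-- The probabilities in a subtree sum to one, so summing over the leaves below an edge of the root
returns the parameter of that edge. Dividing by it, which needs positivity, reduces to the subtree.
-/
theorem leafProb_injective (t : DTree) (x y : (j : t.Node) → Fin (t.extra j + 2) → ℝ)
    (hx : ∀ j, ∑ k, x j k = 1) (hy : ∀ j, ∑ k, y j k = 1) (hx0 : ∀ j k, 0 < x j k)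
    (h : leafProb t x = leafProb t y) : x = y := by
  induction t with
  | leaf => funext j; exact j.elim
  | node k c ih =>
    have h0 : x (Sum.inl ()) = y (Sum.inl ()) := by
      funext i
      have := congrArg (fun f => ∑ l : (c i).Leaf, f ⟨i, l⟩) h
      simp only [leafProb, ← Finset.mul_sum] at this
      rwa [sum_leafProb _ _ fun j => hx (Sum.inr ⟨_, j⟩),
        sum_leafProb _ _ fun j => hy (Sum.inr ⟨_, j⟩), mul_one, mul_one] at this
    have h1 : ∀ i, (fun j => x (Sum.inr ⟨i, j⟩)) = fun j => y (Sum.inr ⟨i, j⟩) := by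
      intro i
      refine ih i _ _ (fun j => hx (Sum.inr ⟨i, j⟩)) (fun j => hy (Sum.inr ⟨i, j⟩))
        (fun j => hx0 (Sum.inr ⟨i, j⟩)) ?_
      funext l
      have := congrFun h ⟨i, l⟩
      simp only [leafProb, ← h0] at this
      exact mul_left_cancel₀ (hx0 (Sum.inl ()) i).ne' this
    funext j
    rcases j with ⟨⟩ | ⟨i, j⟩
    · exact h0
    · exact congrFun (h1 i) j

/-- The masses `q` are not normalised and the total appears as a factor, so that the induction
applies directly to the restriction of `q` to a subtree, even when this restriction vanishes. -/
theorem exists_leafProb (t : DTree) (q : t.Leaf → ℝ) (hq : ∀ l, 0 ≤ q l) :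
    ∃ x : (j : t.Node) → Fin (t.extra j + 2) → ℝ,
      (∀ j, x j ∈ stdSimplex ℝ (Fin (t.extra j + 2))) ∧
        ∀ l, q l = (∑ l', q l') * leafProb t x l := by
  induction t with
  | leaf =>
    refine ⟨fun j => j.elim, fun j => j.elim, fun l => ?_⟩
    change q () = (∑ l : Unit, q l) * 1
    simp
  | node k c ih =>
    choose x hx hxq using fun i => ih i (fun l => q ⟨i, l⟩) (fun l => hq _)
    set s : Fin (k + 2) → ℝ := fun i => ∑ l, q ⟨i, l⟩ with hs
    have hs0 : ∀ i, 0 ≤ s i := fun i => Finset.sum_nonneg fun l _ => hq _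
    have hsum : ∑ l', q l' = ∑ i, s i := Fintype.sum_sigma _
    obtain ⟨r, hr, hrs⟩ : ∃ r ∈ stdSimplex ℝ (Fin (k + 2)), ∀ i, s i = (∑ i, s i) * r i := by
      by_cases h : ∑ i, s i = 0
      -- All masses vanish here, so any point of the simplex will do.
      · refine ⟨Pi.single 0 1, single_mem_stdSimplex _ _, fun i => ?_⟩
        rw [h, zero_mul]
        exact (Finset.sum_eq_zero_iff_of_nonneg fun i _ => hs0 i).1 h i (Finset.mem_univ _)
      · refine ⟨fun i => s i / ∑ i, s i, ⟨fun i => ?_, ?_⟩, fun i => ?_⟩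
        · exact div_nonneg (hs0 i) (Finset.sum_nonneg fun i _ => hs0 i)
        · rw [← Finset.sum_div, div_self h]
        · field_simp
    refine ⟨fun j => match j with
      | Sum.inl _ => r
      | Sum.inr ⟨i, j⟩ => x i j, ?_, ?_⟩
    · rintro (⟨⟩ | ⟨i, j⟩)
      · exact hr
      · exact hx i j
    · rintro ⟨i, l⟩
      rw [hsum]
      change q ⟨i, l⟩ = (∑ i, s i) * (r i * leafProb (c i) (x i) l)
      rw [← mul_assoc, ← hrs]
      exact hxq i l

/-! ### Tree operators -/

/-- Apply the transpose of `O x`, which is its inverse, to `O x √x = e_K`. -/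
theorem orthogonal_last_row {m : ℕ} {O : (Fin (m + 1) → ℝ) → Matrix (Fin (m + 1)) (Fin (m + 1)) ℝ}
    (hO : IsNodeOperator O) {x : Fin (m + 1) → ℝ} (hx : x ∈ stdSimplex ℝ (Fin (m + 1)))
    (k : Fin (m + 1)) : O x (Fin.last m) k = √(x k) := by
  have h1 := hO.mulVec_sqrt x hx
  have h2 := (Matrix.mem_orthogonalGroup_iff' _ _).1 (hO.orthogonal x hx)
  have h3 := congrArg (Matrix.mulVec (O x).transpose) h1
  rw [Matrix.mulVec_mulVec, h2, Matrix.one_mulVec] at h3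
  have := congrFun h3 k
  simpa using this.symm

/-- The last row of the root matrix lives on the output rails of the subtrees, and the block
diagonal structure leaves only the subtree that contains `l`. Each edge on the path thus contributes
one factor `√(x j k)`. -/
theorem treeOperator_out (t : DTree)
    (A : (j : t.Node) → Matrix (Fin (t.extra j + 2)) (Fin (t.extra j + 2)) ℝ)
    (x : (j : t.Node) → Fin (t.extra j + 2) → ℝ) (hx : ∀ j k, 0 ≤ x j k)
    (hA : ∀ j k, A j (Fin.last _) k = √(x j k)) (l : t.Leaf) :
    treeOperator t A t.out l = √(leafProb t x l) := by
  induction t with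
  | leaf =>
    change (1 : Matrix Unit Unit ℝ) () () = √1
    simp
  | node k c ih =>
    obtain ⟨i, l⟩ := l
    simp only [treeOperator, leafProb]
    rw [Matrix.mul_apply]
    have := embed_sum_left (DTree.outs c) (A (Sum.inl ())) (Fin.last (k + 1)) fun l' =>
      Matrix.blockDiagonal' (fun i => treeOperator (c i) fun j => A (Sum.inr ⟨i, j⟩)) l' ⟨i, l⟩
    refine this.trans ?_
    rw [Finset.sum_eq_single i]
    · change A (Sum.inl ()) (Fin.last (k + 1)) i *
        Matrix.blockDiagonal' (fun i => treeOperator (c i) fun j => A (Sum.inr ⟨i, j⟩))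
          ⟨i, (c i).out⟩ ⟨i, l⟩ = _
      rw [Matrix.blockDiagonal'_apply_eq, ih i _ _ (fun j => hx (Sum.inr ⟨i, j⟩))
        (fun j => hA (Sum.inr ⟨i, j⟩)), Real.sqrt_mul (hx (Sum.inl ()) i)]
      congr 1
      exact hA (Sum.inl ()) i
    · intro b _ hb
      change _ * Matrix.blockDiagonal' (fun i => treeOperator (c i) fun j => A (Sum.inr ⟨i, j⟩))
          ⟨b, (c b).out⟩ ⟨i, l⟩ = 0
      rw [Matrix.blockDiagonal'_apply_ne _ _ _ hb, mul_zero]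
    · simp

theorem treeOperator_mem_orthogonal (t : DTree)
    (A : (j : t.Node) → Matrix (Fin (t.extra j + 2)) (Fin (t.extra j + 2)) ℝ)
    (hA : ∀ j, A j ∈ Matrix.orthogonalGroup (Fin (t.extra j + 2)) ℝ) :
    treeOperator t A ∈ Matrix.orthogonalGroup t.Leaf ℝ := by
  induction t with
  | leaf => exact one_mem _
  | node k c ih =>
    refine mul_mem (embed_mem_unitary _ (hA (Sum.inl ()))) ?_
    have := fun i => (Matrix.mem_orthogonalGroup_iff _ _).1
      (ih i (fun j => A (Sum.inr ⟨i, j⟩)) fun j => hA _)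
    rw [Matrix.mem_orthogonalGroup_iff, Matrix.blockDiagonal'_transpose]
    refine (Matrix.blockDiagonal'_mul _ _).symm.trans ?_
    simp only [this]
    exact Matrix.blockDiagonal'_one

theorem measurable_treeOperator (t : DTree) : Measurable (treeOperator t) := by
  induction t with
  | leaf => exact measurable_const
  | node k c ih =>
    simp only [treeOperator]
    refine measurable_matrix_mul ((measurable_embed _).comp (measurable_pi_apply _)) ?_
    refine measurable_pi_iff.2 fun a => measurable_pi_iff.2 fun b => ?_
    obtain ⟨i, l⟩ := a
    obtain ⟨i', l'⟩ := b
    by_cases h : i = i'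
    · subst h
      simp only [Matrix.blockDiagonal'_apply_eq]
      exact measurable_matrix_apply ((ih i).comp (measurable_childParams c i)) l l'
    · simp only [Matrix.blockDiagonal'_apply_ne _ _ _ h]
      exact measurable_const

/-! ### Rotation operators -/

section Rotation

variable {m : ℕ} (G : LabelledTree m) {O : (K : ℕ) → (Fin K → ℝ) → Matrix (Fin K) (Fin K) ℝ}

/-- The last row of the rotation operator of a labelled tree. -/
noncomputable def rowVec (p : (Fin (m + 1) → ℝ) × ((j : G.tree.Node) → Fin (G.tree.extra j + 2) → ℝ)) :
    Fin (m + 1) → ℂ :=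
  fun i => (√(leafProb G.tree p.2 (G.input.symm i)) : ℝ) * Complex.exp (-(p.1 i * Complex.I))

theorem rotation_last (hO : ∀ j : G.tree.Node, IsNodeOperator (O (G.tree.extra j + 2)))
    (φ : Fin (m + 1) → ℝ) {x : (j : G.tree.Node) → Fin (G.tree.extra j + 2) → ℝ}
    (hx : ∀ j, x j ∈ stdSimplex ℝ (Fin (G.tree.extra j + 2))) :
    rotation G O φ x (Fin.last m) = rowVec G (φ, x) := by
  funext i
  have h : G.output.symm (Fin.last m) = G.tree.out := by
    rw [Equiv.symm_apply_eq, G.output_out]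
  simp only [rotation, Matrix.mul_diagonal, Matrix.map_apply, Matrix.reindex_apply,
    Matrix.submatrix_apply, h, rowVec]
  rw [treeOperator_out G.tree _ x (fun j k => (hx j).1 k)
    fun j k => orthogonal_last_row (hO j) (hx j) k]

theorem rotation_mem_unitary (hO : ∀ j : G.tree.Node, IsNodeOperator (O (G.tree.extra j + 2)))
    (φ : Fin (m + 1) → ℝ) {x : (j : G.tree.Node) → Fin (G.tree.extra j + 2) → ℝ}
    (hx : ∀ j, x j ∈ stdSimplex ℝ (Fin (G.tree.extra j + 2))) :
    rotation G O φ x ∈ Matrix.unitaryGroup (Fin (m + 1)) ℂ := by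
  refine mul_mem ?_ ?_
  · have h := (Matrix.mem_orthogonalGroup_iff _ _).1 (treeOperator_mem_orthogonal G.tree
      (fun j => O _ (x j)) fun j => (hO j).orthogonal _ (hx j))
    set T := treeOperator G.tree fun j => O _ (x j)
    rw [Matrix.mem_unitaryGroup_iff]
    have h1 : star ((Matrix.reindex G.output G.input T).map Complex.ofReal) =
        (Matrix.reindex G.input G.output T.transpose).map Complex.ofReal := by
      ext i j
      simp [Matrix.star_apply]
    rw [h1]
    change (Matrix.reindex G.output G.input T).map Complex.ofRealHom *
      (Matrix.reindex G.input G.output T.transpose).map Complex.ofRealHom = 1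
    rw [← Matrix.map_mul]
    simp only [Matrix.reindex_apply, Matrix.submatrix_mul_equiv, h, Matrix.submatrix_one_equiv]
    exact Matrix.map_one _ (map_zero _) (map_one _)
  · rw [Matrix.mem_unitaryGroup_iff, Matrix.star_eq_conjTranspose, Matrix.diagonal_conjTranspose,
      Matrix.diagonal_mul_diagonal, ← Matrix.diagonal_one]
    congr 1
    funext i
    simp [← Complex.exp_conj, ← Complex.exp_add]

theorem measurable_rotation (hO : ∀ j : G.tree.Node, IsNodeOperator (O (G.tree.extra j + 2))) :
    Measurable fun p : (Fin (m + 1) → ℝ) × ((j : G.tree.Node) → Fin (G.tree.extra j + 2) → ℝ) =>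
      rotation G O p.1 p.2 := by
  have h1 : Measurable fun p : (Fin (m + 1) → ℝ) ×
      ((j : G.tree.Node) → Fin (G.tree.extra j + 2) → ℝ) =>
        treeOperator G.tree fun j => O _ (p.2 j) := by
    refine (measurable_treeOperator G.tree).comp (measurable_pi_iff.2 fun j => ?_)
    exact (hO j).measurable.comp ((measurable_pi_apply j).comp measurable_snd)
  refine measurable_matrix_mul ?_ ?_
  · refine measurable_pi_iff.2 fun i => measurable_pi_iff.2 fun j => ?_
    exact Complex.measurable_ofReal.comp (measurable_matrix_apply h1 _ _)
  · refine measurable_pi_iff.2 fun i => measurable_pi_iff.2 fun j => ?_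
    by_cases h : i = j
    · subst h
      simp only [Matrix.diagonal_apply_eq]
      fun_prop
    · simp only [Matrix.diagonal_apply_ne _ h]
      exact measurable_const

theorem measurable_rowVec : Measurable (rowVec G) := by
  refine measurable_pi_iff.2 fun i => Measurable.mul ?_ (by fun_prop)
  exact Complex.measurable_ofReal.comp
    (((measurable_leafProb G.tree _).comp measurable_snd).sqrt)

theorem norm_rowVec (φ : Fin (m + 1) → ℝ) (x : (j : G.tree.Node) → Fin (G.tree.extra j + 2) → ℝ)
    (i : Fin (m + 1)) : ‖rowVec G (φ, x) i‖ = √(leafProb G.tree x (G.input.symm i)) := by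
  rw [rowVec, norm_mul, ← neg_mul, ← Complex.ofReal_neg, Complex.norm_exp_ofReal_mul_I, mul_one,
    Complex.norm_real, Real.norm_of_nonneg (Real.sqrt_nonneg _)]

/-- The phase is `-arg z` reduced modulo `2π` to `[0, 2π)`. -/
theorem exists_mem_Ico_eq_exp (z : ℂ) :
    ∃ φ ∈ Set.Ico 0 (2 * Real.pi), z = (‖z‖ : ℝ) * Complex.exp (-(φ * Complex.I)) := by
  refine ⟨toIcoMod Real.two_pi_pos 0 (-z.arg), by simpa using toIcoMod_mem_Ico Real.two_pi_pos 0 _, ?_⟩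
  conv_lhs => rw [← Complex.norm_mul_exp_arg_mul_I z]
  congr 1
  rw [toIcoMod, Complex.exp_eq_exp_iff_exists_int]
  refine ⟨-toIcoDiv Real.two_pi_pos 0 (-z.arg), ?_⟩
  push_cast [zsmul_eq_mul]
  ring

theorem exp_injOn_Ico {a b : ℝ} (ha : a ∈ Set.Ico 0 (2 * Real.pi))
    (hb : b ∈ Set.Ico 0 (2 * Real.pi))
    (h : Complex.exp (-(a * Complex.I)) = Complex.exp (-(b * Complex.I))) : a = b := by
  rw [Complex.exp_eq_exp_iff_exists_int] at h
  obtain ⟨n, hn⟩ := h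
  have h1 : b = a + n * (2 * Real.pi) := by
    have := congrArg Complex.im hn
    simp at this
    linarith
  have hpi := Real.two_pi_pos
  have h2 : n = 0 := by
    have h3 : (n : ℝ) < 1 := by
      by_contra! h
      nlinarith [ha.1, hb.2]
    have h4 : (-1 : ℝ) < n := by
      by_contra! h
      nlinarith [ha.2, hb.1]
    have h3' : n < 1 := by exact_mod_cast h3
    have h4' : -1 < n := by exact_mod_cast h4
    omega
  simp [h1, h2]

theorem exists_rowVec_eq (r : Fin (m + 1) → ℂ) (hr : ∑ i, ‖r i‖ ^ 2 = 1) :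
    ∃ (φ : Fin (m + 1) → ℝ) (x : (j : G.tree.Node) → Fin (G.tree.extra j + 2) → ℝ),
      (∀ i, φ i ∈ Set.Ico 0 (2 * Real.pi)) ∧
      (∀ j, x j ∈ stdSimplex ℝ (Fin (G.tree.extra j + 2))) ∧ rowVec G (φ, x) = r := by
  choose φ hφ hφr using fun i => exists_mem_Ico_eq_exp (r i)
  obtain ⟨x, hx, hxr⟩ := exists_leafProb G.tree (fun l => ‖r (G.input l)‖ ^ 2)
    fun l => sq_nonneg _
  refine ⟨φ, x, hφ, hx, funext fun i => ?_⟩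
  have h1 : ∑ l, ‖r (G.input l)‖ ^ 2 = 1 :=
    (Equiv.sum_comp G.input fun i => ‖r i‖ ^ 2).trans hr
  rw [h1] at hxr
  rw [hφr i, rowVec]
  congr 2
  have := hxr (G.input.symm i)
  rw [one_mul, Equiv.apply_symm_apply] at this
  rw [← this, Real.sqrt_sq (norm_nonneg _)]

/-- The moduli of the entries determine the leaf probabilities, hence the node parameters. Since no
entry vanishes, the arguments determine the phases. -/
theorem rowVec_injective {φ ψ : Fin (m + 1) → ℝ}
    {x y : (j : G.tree.Node) → Fin (G.tree.extra j + 2) → ℝ}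
    (hφ : ∀ i, φ i ∈ Set.Ico 0 (2 * Real.pi)) (hψ : ∀ i, ψ i ∈ Set.Ico 0 (2 * Real.pi))
    (hx : ∀ j, ∑ k, x j k = 1) (hy : ∀ j, ∑ k, y j k = 1)
    (hx0 : ∀ j k, 0 < x j k) (hy0 : ∀ j k, 0 < y j k)
    (h : rowVec G (φ, x) = rowVec G (ψ, y)) : φ = ψ ∧ x = y := by
  have hxy : leafProb G.tree x = leafProb G.tree y := by
    funext l
    have := congrArg (fun z => ‖z‖) (congrFun h (G.input l))
    simp only [norm_rowVec, Equiv.symm_apply_apply] at this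
    rwa [Real.sqrt_inj (leafProb_pos _ _ hx0 _).le (leafProb_pos _ _ hy0 _).le] at this
  refine ⟨funext fun i => ?_, leafProb_injective _ _ _ hx hy hx0 hxy⟩
  have := congrFun h i
  simp only [rowVec, ← hxy] at this
  refine exp_injOn_Ico (hφ i) (hψ i) (mul_left_cancel₀ ?_ this)
  exact_mod_cast (Real.sqrt_pos.2 (leafProb_pos _ _ hx0 _)).ne'

end Rotation

/-! ### Unitary matrices with a prescribed last row -/

theorem unitary_row_norm {N : ℕ} {U : Matrix (Fin N) (Fin N) ℂ}
    (hU : U ∈ Matrix.unitaryGroup (Fin N) ℂ) (i : Fin N) : ∑ j, ‖U i j‖ ^ 2 = 1 := by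
  have h := congrFun (congrFun ((Matrix.mem_unitaryGroup_iff).1 hU) i) i
  rw [Matrix.mul_apply, Matrix.one_apply_eq] at h
  have h2 : ((∑ j, ‖U i j‖ ^ 2 : ℝ) : ℂ) = 1 := by
    rw [← h]
    push_cast
    refine Finset.sum_congr rfl fun j _ => ?_
    rw [Matrix.star_apply]
    exact (Complex.mul_conj' _).symm
  exact_mod_cast h2

/-- Orthogonality of the other rows to the last row `e_N` makes the last column vanish above the
corner. -/
theorem exists_embed_of_last_row {N : ℕ} {U : Matrix (Fin (N + 1)) (Fin (N + 1)) ℂ}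
    (hU : U ∈ Matrix.unitaryGroup (Fin (N + 1)) ℂ)
    (h : U (Fin.last N) = Pi.single (Fin.last N) 1) :
    ∃ V ∈ Matrix.unitaryGroup (Fin N) ℂ, U = embed Fin.castSuccEmb V := by
  have hcol : ∀ i : Fin N, U i.castSucc (Fin.last N) = 0 := by
    intro i
    have h1 := congrFun (congrFun ((Matrix.mem_unitaryGroup_iff).1 hU) i.castSucc) (Fin.last N)
    rw [Matrix.mul_apply, Matrix.one_apply_ne (Fin.castSucc_lt_last i).ne] at h1
    simpa [Matrix.star_apply, h, Pi.single_apply] using h1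
  have hne : ∀ i : Fin (N + 1), (∀ a : Fin N, i ≠ Fin.castSuccEmb a) → i = Fin.last N := by
    intro i hi
    by_contra h'
    exact hi (i.castPred h') (by simp)
  have hUe : embed Fin.castSuccEmb (U.submatrix Fin.castSucc Fin.castSucc) = U := by
    refine embed_ext (fun a b => rfl) ?_ ?_
    · intro i j hi
      rw [hne i hi, h]
      simp [Pi.single_apply, eq_comm]
    · intro i j hj
      rw [hne j hj]
      refine Fin.lastCases ?_ (fun i => ?_) i
      · simp [h]
      · simp [hcol, (Fin.castSucc_lt_last i).ne]
  refine ⟨_, ?_, hUe.symm⟩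
  rw [Matrix.mem_unitaryGroup_iff]
  refine embed_injective (Fin.castSuccEmb (n := N)) ?_
  rw [embed_mul, ← embed_star, hUe, embed_one]
  exact (Matrix.mem_unitaryGroup_iff).1 hU

theorem embed_castSucc_mul_last {N : ℕ} (V : Matrix (Fin N) (Fin N) ℂ)
    (R : Matrix (Fin (N + 1)) (Fin (N + 1)) ℂ) :
    (embed Fin.castSuccEmb V * R) (Fin.last N) = R (Fin.last N) := by
  funext j
  rw [Matrix.mul_apply, embed_sum_left']
  intro a
  exact (Fin.castSucc_lt_last a).ne'

/-- The last row of `U R*` equals that of `R R* = 1`, so `U R*` has the form `V ⊕ 1`. -/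
theorem exists_eq_embed_mul {N : ℕ} {U R : Matrix (Fin (N + 1)) (Fin (N + 1)) ℂ}
    (hU : U ∈ Matrix.unitaryGroup (Fin (N + 1)) ℂ) (hR : R ∈ Matrix.unitaryGroup (Fin (N + 1)) ℂ)
    (h : U (Fin.last N) = R (Fin.last N)) :
    ∃ V ∈ Matrix.unitaryGroup (Fin N) ℂ, U = embed Fin.castSuccEmb V * R := by
  obtain ⟨V, hV, hVU⟩ := exists_embed_of_last_row (U := U * star R)
    (mul_mem hU (Unitary.star_mem hR)) (by
      funext j
      have h1 := congrFun (congrFun ((Matrix.mem_unitaryGroup_iff).1 hR) (Fin.last N)) j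
      rw [Matrix.mul_apply] at h1 ⊢
      rw [h, h1]
      simp [Matrix.one_apply, Pi.single_apply, eq_comm])
  refine ⟨V, hV, ?_⟩
  rw [← hVU, mul_assoc, (Matrix.mem_unitaryGroup_iff').1 hR, mul_one]

/-! ### Cascades -/

section Cascade

variable {N : ℕ} {O : (K : ℕ) → (Fin K → ℝ) → Matrix (Fin K) (Fin K) ℝ}

/-- The first `N` trees of a family of `N + 1` trees. -/
abbrev initTrees (G : (n : Fin (N + 1)) → LabelledTree n.val) : (n : Fin N) → LabelledTree n.val :=
  fun n => G n.castSucc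

/-- The last tree of a family of `N + 1` trees. -/
abbrev lastTree (G : (n : Fin (N + 1)) → LabelledTree n.val) : LabelledTree N := G (Fin.last N)

/-- The parameters of the first `N` trees. -/
abbrev initParams {G : (n : Fin (N + 1)) → LabelledTree n.val} (p : Params G) :
    Params (initTrees G) :=
  fun n => p n.castSucc

/-- The embedding into `N + 1` coordinates factors through the one into `N` coordinates for every
factor but the last, and it is multiplicative. The last factor is embedded along the identity. -/
theorem prod_ofFn_embed_succ (R : (n : Fin (N + 1)) → Matrix (Fin (n.val + 1)) (Fin (n.val + 1)) ℂ) :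
    (List.ofFn fun n : Fin (N + 1) => embed (Fin.castLEEmb n.isLt) (R n)).prod =
      embed (Fin.castSuccEmb (n := N)) (List.ofFn fun n : Fin N =>
        embed (Fin.castLEEmb n.isLt) (R n.castSucc)).prod *
          (show Matrix (Fin (N + 1)) (Fin (N + 1)) ℂ from R (Fin.last N)) := by
  rw [List.ofFn_succ', List.prod_concat]
  have h1 : embed (Fin.castLEEmb (Fin.last N).isLt) (R (Fin.last N)) =
      (show Matrix (Fin (N + 1)) (Fin (N + 1)) ℂ from R (Fin.last N)) :=
    embed_refl (ι := Fin (N + 1)) _ (fun a => rfl) _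
  have h2 := map_list_prod (embedHom (R := ℂ) (Fin.castSuccEmb (n := N)))
    (List.ofFn fun n : Fin N => embed (Fin.castLEEmb n.isLt) (R n.castSucc))
  rw [List.map_ofFn] at h2
  have h3 : (fun n : Fin N => embed (Fin.castLEEmb n.castSucc.isLt) (R n.castSucc)) =
      embedHom (R := ℂ) (Fin.castSuccEmb (n := N)) ∘
        fun n : Fin N => embed (Fin.castLEEmb n.isLt) (R n.castSucc) :=
    funext fun n => by
      have h4 : (Fin.castLEEmb n.isLt).trans (Fin.castSuccEmb (n := N)) =
        Fin.castLEEmb (n := n.val + 1) n.castSucc.isLt := rfl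
      have h5 := embed_embed (ι := Fin (n.val + 1)) (R := ℂ) (Fin.castLEEmb n.isLt)
        (Fin.castSuccEmb (n := N)) (R n.castSucc)
      rw [h4] at h5
      exact h5.symm
  rw [h3]
  exact congrArg₂ (fun A B : Matrix (Fin (N + 1)) (Fin (N + 1)) ℂ => A * B) h2.symm h1

theorem cascade_succ (G : (n : Fin (N + 1)) → LabelledTree n.val) (p : Params G) :
    cascade G O p = embed Fin.castSuccEmb (cascade (initTrees G) O (initParams p)) *
      rotation (lastTree G) O (p (Fin.last N)).1 (p (Fin.last N)).2 :=
  prod_ofFn_embed_succ fun n => rotation (G n) O (p n).1 (p n).2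

theorem cascade_mem_unitary (G : (n : Fin N) → LabelledTree n.val)
    (hO : ∀ (n : Fin N) (j : (G n).tree.Node), IsNodeOperator (O ((G n).tree.extra j + 2)))
    {p : Params G} (hp : p ∈ admissible G) :
    cascade G O p ∈ Matrix.unitaryGroup (Fin N) ℂ := by
  refine list_prod_mem fun A hA => ?_
  obtain ⟨n, rfl⟩ := (List.mem_ofFn' _ _).1 hA
  exact embed_mem_unitary _ (rotation_mem_unitary (G n) (hO n) _ (hp n).2)

theorem exists_params (G : (n : Fin (N + 1)) → LabelledTree n.val) (p : Params (initTrees G))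
    (r : (Fin (N + 1) → ℝ) ×
      ((j : (lastTree G).tree.Node) → Fin ((lastTree G).tree.extra j + 2) → ℝ)) :
    ∃ q : Params G, initParams q = p ∧ q (Fin.last N) = r :=
  ⟨Fin.snoc (α := fun n => (Fin (n.val + 1) → ℝ) ×
      ((j : (G n).tree.Node) → Fin ((G n).tree.extra j + 2) → ℝ)) p r,
    funext fun n => Fin.snoc_castSucc (α := fun n => (Fin (n.val + 1) → ℝ) ×
      ((j : (G n).tree.Node) → Fin ((G n).tree.extra j + 2) → ℝ)) r p n, Fin.snoc_last _ _⟩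

theorem cascade_surjective (G : (n : Fin N) → LabelledTree n.val)
    (hO : ∀ (n : Fin N) (j : (G n).tree.Node), IsNodeOperator (O ((G n).tree.extra j + 2)))
    {U : Matrix (Fin N) (Fin N) ℂ} (hU : U ∈ Matrix.unitaryGroup (Fin N) ℂ) :
    ∃ p ∈ admissible G, cascade G O p = U := by
  induction N with
  | zero =>
    exact ⟨fun n => n.elim0, fun n => n.elim0, Subsingleton.elim _ _⟩
  | succ N ih =>
    obtain ⟨φ, x, hφ, hx, hr⟩ := exists_rowVec_eq (lastTree G) (U (Fin.last N))
      (unitary_row_norm hU _)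
    rw [← rotation_last (lastTree G) (hO (Fin.last N)) φ hx] at hr
    obtain ⟨V, hV, rfl⟩ := exists_eq_embed_mul hU
      (rotation_mem_unitary (lastTree G) (hO (Fin.last N)) φ hx) hr.symm
    obtain ⟨p, hp, rfl⟩ := ih (initTrees G) (fun n => hO n.castSucc) hV
    obtain ⟨q, hqi, hql⟩ := exists_params G p (φ, x)
    refine ⟨q, fun n => ?_, ?_⟩
    · induction n using Fin.lastCases with
      | last => rw [hql]; exact ⟨hφ, hx⟩
      | cast n => have := congrFun hqi n; rw [initParams] at this; rw [this]; exact hp n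
    · rw [cascade_succ, hql, hqi]

theorem cascade_injOn (G : (n : Fin N) → LabelledTree n.val)
    (hO : ∀ (n : Fin N) (j : (G n).tree.Node), IsNodeOperator (O ((G n).tree.extra j + 2))) :
    Set.InjOn (cascade G O) (regular G) := by
  induction N with
  | zero => exact fun _ _ _ _ _ => funext fun n => n.elim0
  | succ N ih =>
    intro p hp q hq h
    rw [cascade_succ, cascade_succ] at h
    have hl : p (Fin.last N) = q (Fin.last N) := by
      have h1 := congrFun h (Fin.last N)
      rw [embed_castSucc_mul_last, embed_castSucc_mul_last,
        rotation_last (lastTree G) (hO (Fin.last N)) _ (hp.1 (Fin.last N)).2,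
        rotation_last (lastTree G) (hO (Fin.last N)) _ (hq.1 (Fin.last N)).2] at h1
      have := rowVec_injective (lastTree G) (hp.1 (Fin.last N)).1 (hq.1 (Fin.last N)).1
        (fun j => ((hp.1 (Fin.last N)).2 j).2) (fun j => ((hq.1 (Fin.last N)).2 j).2)
        (hp.2 (Fin.last N)) (hq.2 (Fin.last N)) h1
      exact Prod.ext this.1 this.2
    have hi : initParams p = initParams q := by
      refine ih (initTrees G) (fun n => hO n.castSucc)
        ⟨fun n => hp.1 n.castSucc, fun n => hp.2 n.castSucc⟩
        ⟨fun n => hq.1 n.castSucc, fun n => hq.2 n.castSucc⟩ ?_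
      -- The last rotations agree and are unitary, so they cancel from the right.
      refine embed_injective (Fin.castSuccEmb (n := N)) ?_
      rw [hl] at h
      have hu := (Matrix.mem_unitaryGroup_iff).1 (rotation_mem_unitary (lastTree G)
        (hO (Fin.last N)) (q (Fin.last N)).1 (hq.1 (Fin.last N)).2)
      have := congrArg (fun A => A * star (rotation (lastTree G) O (q (Fin.last N)).1
        (q (Fin.last N)).2)) h
      simpa only [mul_assoc, hu, mul_one] using this
    funext n
    refine Fin.lastCases hl (fun n => ?_) n
    exact congrFun hi n

theorem measurable_cascade (G : (n : Fin N) → LabelledTree n.val)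
    (hO : ∀ (n : Fin N) (j : (G n).tree.Node), IsNodeOperator (O ((G n).tree.extra j + 2))) :
    Measurable (cascade G O) := by
  induction N with
  | zero => exact measurable_of_subsingleton_codomain _
  | succ N ih =>
    have : cascade G O = fun p => embed Fin.castSuccEmb (cascade (initTrees G) O (initParams p)) *
      rotation (lastTree G) O (p (Fin.last N)).1 (p (Fin.last N)).2 := funext (cascade_succ G)
    rw [this]
    refine measurable_matrix_mul ((measurable_embed _).comp
      ((ih (initTrees G) fun n => hO n.castSucc).comp ?_)) ?_
    · exact measurable_pi_iff.2 fun n => measurable_pi_apply n.castSucc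
    · exact (measurable_rotation (lastTree G) (hO (Fin.last N))).comp
        (measurable_pi_apply (Fin.last N))

end Cascade

/-! ### Product measures -/

section PiMeasures

/-- Both σ-finite measures agree on products of boxes, which form a generating π-system. -/
theorem pi_prod_map_unzip {ι : Type*} [Fintype ι] {α β : ι → Type*} [∀ i, MeasurableSpace (α i)]
    [∀ i, MeasurableSpace (β i)] (μ : ∀ i, Measure (α i)) (ν : ∀ i, Measure (β i))
    [∀ i, SigmaFinite (μ i)] [∀ i, SigmaFinite (ν i)] :
    (Measure.pi fun i => (μ i).prod (ν i)).map (fun x => (fun i => (x i).1, fun i => (x i).2)) =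
      (Measure.pi μ).prod (Measure.pi ν) := by
  refine (Measure.FiniteSpanningSetsIn.ext ?_ (isPiSystem_pi.prod isPiSystem_pi)
      ((Measure.FiniteSpanningSetsIn.pi fun i ↦ (μ i).toFiniteSpanningSetsIn).prod
      (Measure.FiniteSpanningSetsIn.pi (fun i ↦ (ν i).toFiniteSpanningSetsIn))) ?_).symm
  · refine (generateFrom_eq_prod generateFrom_pi generateFrom_pi ?_ ?_).symm
    · exact (Measure.FiniteSpanningSetsIn.pi
        (fun i ↦ (μ i).toFiniteSpanningSetsIn)).isCountablySpanning
    · exact (Measure.FiniteSpanningSetsIn.pi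
        (fun i ↦ (ν i).toFiniteSpanningSetsIn)).isCountablySpanning
  · rintro _ ⟨_, ⟨s, hs, rfl⟩, ⟨_, ⟨t, ht, rfl⟩, rfl⟩⟩
    rw [Measure.map_apply (by fun_prop) ((MeasurableSet.univ_pi fun i => hs i trivial).prod
      (MeasurableSet.univ_pi fun i => ht i trivial))]
    rw [show (fun x : ∀ i, α i × β i => ((fun i => (x i).1 : ∀ i, α i),
        (fun i => (x i).2 : ∀ i, β i))) ⁻¹' (Set.univ.pi s ×ˢ Set.univ.pi t) =
        Set.univ.pi fun i ↦ s i ×ˢ t i by ext; simp [Set.mem_pi, forall_and]]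
    simp_rw [Measure.pi_pi, Measure.prod_prod, Measure.pi_pi, Finset.prod_mul_distrib]

theorem prod_pi_map_zip {ι : Type*} [Fintype ι] {α β : ι → Type*} [∀ i, MeasurableSpace (α i)]
    [∀ i, MeasurableSpace (β i)] (μ : ∀ i, Measure (α i)) (ν : ∀ i, Measure (β i))
    [∀ i, SigmaFinite (μ i)] [∀ i, SigmaFinite (ν i)] :
    ((Measure.pi μ).prod (Measure.pi ν)).map (fun z i => (z.1 i, z.2 i)) =
      Measure.pi fun i => (μ i).prod (ν i) := by
  rw [← pi_prod_map_unzip, Measure.map_map (by fun_prop) (by fun_prop)]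
  exact Measure.map_id

/-- `Measure.pi_eq` identifies images inside a product space, so the inverse map `Fin.snoc` is
treated first and then undone. `pi_node_map` uses the same device. -/
theorem pi_map_snoc {N : ℕ} {α : Fin (N + 1) → Type*} [∀ i, MeasurableSpace (α i)]
    (μ : ∀ i, Measure (α i)) [∀ i, SigmaFinite (μ i)] :
    (Measure.pi μ).map (fun x => (fun n : Fin N => x n.castSucc, x (Fin.last N))) =
      (Measure.pi fun n : Fin N => μ n.castSucc).prod (μ (Fin.last N)) := by
  have hm : Measurable fun z : (∀ n : Fin N, α n.castSucc) × α (Fin.last N) =>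
      Fin.snoc (α := α) z.1 z.2 := by
    refine measurable_pi_iff.2 fun n => ?_
    induction n using Fin.lastCases with
    | last => simpa using measurable_snd
    | cast n =>
      simp only [Fin.snoc_castSucc]
      exact (measurable_pi_apply n).comp measurable_fst
  have h : Measure.pi μ = ((Measure.pi fun n : Fin N => μ n.castSucc).prod (μ (Fin.last N))).map
      fun z => Fin.snoc (α := α) z.1 z.2 := by
    refine Measure.pi_eq fun s hs => ?_
    rw [Measure.map_apply hm (MeasurableSet.univ_pi hs), Fin.prod_univ_castSucc, ← Measure.pi_pi,
      ← Measure.prod_prod]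
    congr 1
    ext z
    simp [Set.mem_pi, Fin.forall_fin_succ']
  rw [h, Measure.map_map (by fun_prop) hm]
  convert Measure.map_id
  ext z n
  · simp
  · simp

/-- Separates the root from the families of nodes of its subtrees, as the induction over trees
requires. -/
theorem pi_node_map {k : ℕ} (c : Fin (k + 2) → DTree) {X : (DTree.node k c).Node → Type*}
    [∀ j, MeasurableSpace (X j)] (μ : ∀ j, Measure (X j)) [∀ j, SigmaFinite (μ j)] :
    (Measure.pi μ).map (fun x => (x (Sum.inl ()), fun i (j : (c i).Node) => x (Sum.inr ⟨i, j⟩))) =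
      (μ (Sum.inl ())).prod (Measure.pi fun i => Measure.pi fun j : (c i).Node =>
        μ (Sum.inr ⟨i, j⟩)) := by
  set f : (X (Sum.inl ()) × ∀ i, ∀ j : (c i).Node, X (Sum.inr ⟨i, j⟩)) → ∀ j, X j := fun z j =>
    match j with
    | Sum.inl () => z.1
    | Sum.inr ⟨i, j⟩ => z.2 i j with hf
  have hm : Measurable f := by
    refine measurable_pi_iff.2 fun j => ?_
    rcases j with ⟨⟩ | ⟨i, j⟩
    · exact measurable_fst
    · exact (measurable_pi_apply j).comp ((measurable_pi_apply i).comp measurable_snd)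
  have hm' : Measurable fun x : ∀ j, X j =>
      (x (Sum.inl ()), fun i (j : (c i).Node) => x (Sum.inr ⟨i, j⟩)) :=
    (measurable_pi_apply _).prodMk (measurable_pi_iff.2 fun i => measurable_childParams c i)
  have h : Measure.pi μ = ((μ (Sum.inl ())).prod (Measure.pi fun i =>
      Measure.pi fun j : (c i).Node => μ (Sum.inr ⟨i, j⟩))).map f := by
    refine Measure.pi_eq fun s hs => ?_
    have h1 : ∏ j, μ j (s j) = μ (Sum.inl ()) (s (Sum.inl ())) *
        ∏ i, ∏ j : (c i).Node, μ (Sum.inr ⟨i, j⟩) (s (Sum.inr ⟨i, j⟩)) := by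
      refine (Fintype.prod_sum_type (α₁ := Unit) (α₂ := Σ i, (c i).Node) _).trans ?_
      rw [Fintype.prod_sigma]
      simp
    rw [Measure.map_apply hm (MeasurableSet.univ_pi hs), h1]
    simp only [← Measure.pi_pi]
    rw [← Measure.prod_prod]
    congr 1
    ext z
    simp only [Set.mem_preimage, Set.mem_pi, Set.mem_univ, true_implies, Set.mem_prod]
    exact ⟨fun h => ⟨h (Sum.inl ()), fun i j => h (Sum.inr ⟨i, j⟩)⟩,
      fun h j => match j with
        | Sum.inl () => h.1
        | Sum.inr ⟨i, j⟩ => h.2 i j⟩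
  rw [h, Measure.map_map hm' hm]
  exact Measure.map_id

theorem pi_leaf_map {k : ℕ} (c : Fin (k + 2) → DTree) {X : Type*} [MeasurableSpace X]
    (μ : Measure X) [SigmaFinite μ] :
    (Measure.pi fun i => Measure.pi fun _ : (c i).Leaf => μ).map
      (fun x (l : (DTree.node k c).Leaf) => x l.1 l.2) = Measure.pi fun _ => μ := by
  symm
  refine Measure.pi_eq fun s hs => ?_
  have h1 : ∏ l, μ (s l) = ∏ i, ∏ l : (c i).Leaf, μ (s ⟨i, l⟩) :=
    Fintype.prod_sigma (ι := Fin (k + 2)) _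
  rw [Measure.map_apply (by fun_prop) (MeasurableSet.univ_pi hs), h1]
  simp only [← Measure.pi_pi]
  congr 1
  ext z
  simp only [Set.mem_preimage, Set.mem_pi, Set.mem_univ, true_implies]
  exact ⟨fun h i l => h ⟨i, l⟩, fun h l => h l.1 l.2⟩

theorem lintegral_fin_prod {n : ℕ} {X : Type*} [MeasurableSpace X] (μ : Measure X) [SigmaFinite μ]
    (f : Fin n → X → ℝ≥0∞) (hf : ∀ i, Measurable (f i)) :
    ∫⁻ x, ∏ i, f i (x i) ∂(Measure.pi fun _ : Fin n => μ) = ∏ i, ∫⁻ x, f i x ∂μ := by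
  induction n with
  | zero => simp
  | succ n ih =>
    have h := pi_map_snoc (fun _ : Fin (n + 1) => μ)
    have h1 : ∫⁻ z, (∏ i : Fin n, f i.castSucc (z.1 i)) * f (Fin.last n) z.2
        ∂((Measure.pi fun _ : Fin n => μ).prod μ) = ∏ i, ∫⁻ x, f i x ∂μ := by
      rw [Fin.prod_univ_castSucc, ← ih _ fun i => hf _]
      exact lintegral_prod_mul (μ := Measure.pi fun _ : Fin n => μ) (ν := μ) (f := fun y : Fin n → X => ∏ i, f i.castSucc (y i))
        (Finset.measurable_prod _ fun i _ =>
          (hf _).comp (measurable_pi_apply i)).aemeasurable (hf _).aemeasurable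
    rw [← h1, ← h, lintegral_map (by fun_prop) (by fun_prop)]
    simp only [Fin.prod_univ_castSucc]

theorem pi_withDensity {n : ℕ} {X : Type*} [MeasurableSpace X] (μ : Measure X) [SigmaFinite μ]
    (f : Fin n → X → ℝ≥0∞) (hf : ∀ i, Measurable (f i)) [∀ i, SigmaFinite (μ.withDensity (f i))] :
    (Measure.pi fun i => μ.withDensity (f i)) =
      (Measure.pi fun _ : Fin n => μ).withDensity fun x => ∏ i, f i (x i) := by
  refine Measure.pi_eq fun s hs => ?_
  rw [withDensity_apply _ (MeasurableSet.univ_pi hs), ← lintegral_indicator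
    (MeasurableSet.univ_pi hs)]
  have h : ∀ x : Fin n → X, (Set.univ.pi s).indicator (fun x => ∏ i, f i (x i)) x =
      ∏ i, (s i).indicator (f i) (x i) := by
    intro x
    classical
    by_cases hx : x ∈ Set.univ.pi s
    · rw [Set.indicator_of_mem hx]
      exact Finset.prod_congr rfl fun i _ => (Set.indicator_of_mem (hx i trivial) _).symm
    · rw [Set.indicator_of_notMem hx]
      simp only [Set.mem_pi, Set.mem_univ, true_implies, not_forall] at hx
      obtain ⟨i, hi⟩ := hx
      exact (Finset.prod_eq_zero (Finset.mem_univ i) (Set.indicator_of_notMem hi _)).symm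
  simp only [h]
  rw [lintegral_fin_prod μ _ fun i => (hf i).indicator (hs i)]
  refine Finset.prod_congr rfl fun i _ => ?_
  rw [lintegral_indicator (hs i), withDensity_apply _ (hs i)]

end PiMeasures

/-! ### Gamma and Dirichlet distributions -/

theorem measurable_completeSimplex {m : ℕ} :
    Measurable (completeSimplex : (Fin m → ℝ) → Fin (m + 1) → ℝ) := by
  refine measurable_pi_iff.2 fun k => ?_
  induction k using Fin.lastCases with
  | last => simp only [completeSimplex, Fin.snoc_last]; fun_prop
  | cast k => simp only [completeSimplex, Fin.snoc_castSucc]; fun_prop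

theorem sum_completeSimplex {m : ℕ} (x : Fin m → ℝ) : ∑ k, completeSimplex x k = 1 := by
  simp [Fin.sum_univ_castSucc, completeSimplex]

theorem completeSimplex_pos_iff {m : ℕ} (x : Fin m → ℝ) :
    (∀ k, 0 < completeSimplex x k) ↔ x ∈ {x : Fin m → ℝ | (∀ i, 0 < x i) ∧ ∑ i, x i < 1} := by
  simp [Fin.forall_fin_succ', completeSimplex]

theorem measurableSet_openSimplex {m : ℕ} :
    MeasurableSet {x : Fin m → ℝ | (∀ i, 0 < x i) ∧ ∑ i, x i < 1} := by
  have h1 := MeasurableSet.univ_pi fun _ : Fin m => (measurableSet_Ioi : MeasurableSet (Set.Ioi (0 : ℝ)))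
  have h2 : MeasurableSet {x : Fin m → ℝ | ∑ i, x i < 1} :=
    measurableSet_lt (by fun_prop) (by fun_prop)
  convert h1.inter h2 using 1
  ext x
  simp [Set.mem_pi]

theorem measurable_dirichletPDF {K : ℕ} (α : Fin K → ℝ) : Measurable (dirichletPDF α) := by
  unfold dirichletPDF
  fun_prop

/-- The density of the gamma distribution with rate one, vanishing outside `(0, ∞)`. -/
noncomputable def stdGammaPDF (a x : ℝ) : ℝ≥0∞ :=
  ENNReal.ofReal (if 0 < x then x ^ (a - 1) * Real.exp (-x) / Real.Gamma a else 0)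

theorem measurable_stdGammaPDF (a : ℝ) : Measurable (stdGammaPDF a) :=
  (Measurable.ite measurableSet_Ioi (by fun_prop) measurable_const).ennreal_ofReal

/-- The two densities can differ only at `0`. Vanishing there as well matches the strict
inequalities that define the open simplex. -/
theorem gammaMeasure_one_eq (a : ℝ) :
    ProbabilityTheory.gammaMeasure a 1 = volume.withDensity (stdGammaPDF a) := by
  refine withDensity_congr_ae ?_
  filter_upwards [Measure.ae_ne volume (0 : ℝ)] with x hx
  unfold ProbabilityTheory.gammaPDF ProbabilityTheory.gammaPDFReal stdGammaPDF
  congr 1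
  rcases lt_or_gt_of_ne hx with h | h
  · rw [if_neg h.not_ge, if_neg h.le.not_gt]
  · rw [if_pos h.le, if_pos h, Real.one_rpow, one_mul]
    ring

/-- The identity of densities behind Gamma × Dirichlet, with `s ^ m` the Jacobian of `y = s x`.
There are `m + 1` coordinates, so the exponents of `s` add up to `m + ∑ (α k - 1) = ∑ α k - 1`; the
exponentials combine to `exp (-s)` because the `x k` sum to one. -/
theorem prod_stdGammaPDF {m : ℕ} {α : Fin (m + 1) → ℝ} (hα : ∀ k, 0 < α k) {s : ℝ} (hs : 0 < s)
    (x : Fin m → ℝ) :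
    ENNReal.ofReal (s ^ m) * ∏ k, stdGammaPDF (α k) (s * completeSimplex x k) =
      stdGammaPDF (∑ k, α k) s *
        {x : Fin m → ℝ | (∀ i, 0 < x i) ∧ ∑ i, x i < 1}.indicator
          (fun x => ENNReal.ofReal (dirichletPDF α (completeSimplex x))) x := by
  by_cases hx : ∀ k, 0 < completeSimplex x k
  · rw [Set.indicator_of_mem ((completeSimplex_pos_iff x).1 hx)]
    have hsx : ∀ k, 0 < s * completeSimplex x k := fun k => mul_pos hs (hx k)
    have hG : ∀ k, 0 < Real.Gamma (α k) := fun k => Real.Gamma_pos_of_pos (hα k)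
    have hGs : 0 < Real.Gamma (∑ k, α k) :=
      Real.Gamma_pos_of_pos (Finset.sum_pos (fun k _ => hα k) Finset.univ_nonempty)
    unfold stdGammaPDF
    simp only [if_pos hs, if_pos (hsx _)]
    rw [← ENNReal.ofReal_prod_of_nonneg fun k _ => by have := hsx k; have := hG k; positivity,
      ← ENNReal.ofReal_mul (by positivity), ← ENNReal.ofReal_mul (by positivity)]
    congr 1
    unfold dirichletPDF
    rw [Finset.prod_div_distrib, Finset.prod_mul_distrib, ← Real.exp_sum, Finset.sum_neg_distrib,
      ← Finset.mul_sum, sum_completeSimplex, mul_one]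
    simp only [Real.mul_rpow hs.le (hx _).le]
    rw [Finset.prod_mul_distrib, ← Real.rpow_sum_of_pos hs]
    have h1 : s ^ m * s ^ (∑ k, (α k - 1)) = s ^ (∑ k, α k - 1) := by
      rw [← Real.rpow_natCast, ← Real.rpow_add hs]
      congr 1
      simp
      ring
    have h2 : ∏ k, Real.Gamma (α k) ≠ 0 := Finset.prod_ne_zero_iff.2 fun k _ => (hG k).ne'
    rw [← h1]
    field_simp
  · rw [Set.indicator_of_notMem fun h => hx ((completeSimplex_pos_iff x).2 h)]
    push Not at hx
    obtain ⟨k, hk⟩ := hx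
    rw [Finset.prod_eq_zero (Finset.mem_univ k), mul_zero, mul_zero]
    rw [stdGammaPDF, if_neg (mul_nonpos_of_nonneg_of_nonpos hs.le hk).not_gt, ENNReal.ofReal_zero]

theorem lintegral_eq_scale {m : ℕ} {s : ℝ} (hs : 0 < s) {F : (Fin m → ℝ) → ℝ≥0∞}
    (hF : Measurable F) :
    ∫⁻ y, F y = ENNReal.ofReal (s ^ m) * ∫⁻ x, F (s • x) := by
  have h := Measure.map_addHaar_smul (volume : Measure (Fin m → ℝ)) hs.ne'
  have h2 : ∫⁻ x, F (s • x) = ENNReal.ofReal ((s ^ m)⁻¹) * ∫⁻ y, F y := by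
    rw [← lintegral_map hF (measurable_const_smul s), h, lintegral_smul_measure, smul_eq_mul,
      abs_of_pos (by positivity)]
    simp
  rw [h2, ← mul_assoc, ← ENNReal.ofReal_mul (by positivity), mul_inv_cancel₀ (by positivity)]
  simp

/-- Coordinates `y = s x` with `s` the total. The change of variables is a shear, which turns the
last coordinate into the total, followed by a dilation of the first `m` coordinates for fixed `s`.
Translation invariance and scaling of Lebesgue measure therefore suffice. -/
theorem lintegral_simplex_coordinates {m : ℕ} {F : (Fin (m + 1) → ℝ) → ℝ≥0∞} (hF : Measurable F)
    (hF0 : ∀ y, (∃ k, y k ≤ 0) → F y = 0) :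
    ∫⁻ y, F y = ∫⁻ s in Set.Ioi (0 : ℝ), ENNReal.ofReal (s ^ m) *
      ∫⁻ x, F (fun k => s * completeSimplex x k) := by
  have hsn : Measurable fun z : (Fin m → ℝ) × ℝ => (Fin.snoc (α := fun _ => ℝ) z.1 z.2 :
      Fin (m + 1) → ℝ) := by
    refine measurable_pi_iff.2 fun n => ?_
    induction n using Fin.lastCases with
    | last => simpa using measurable_snd
    | cast n => simp only [Fin.snoc_castSucc]; fun_prop
  have hFs : Measurable fun z : (Fin m → ℝ) × ℝ => F (Fin.snoc (α := fun _ => ℝ) z.1 z.2) :=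
    hF.comp hsn
  have h1 : ∫⁻ y, F y = ∫⁻ z, F (Fin.snoc (α := fun _ => ℝ) z.1 z.2)
      ∂((volume : Measure (Fin m → ℝ)).prod (volume : Measure ℝ)) := by
    have := pi_map_snoc (fun _ : Fin (m + 1) => (volume : Measure ℝ))
    rw [volume_pi, volume_pi, ← this, lintegral_map hFs (by fun_prop)]
    refine lintegral_congr fun y => congrArg F (funext fun k => ?_)
    induction k using Fin.lastCases with
    | last => simp
    | cast k => simp
  rw [h1, lintegral_prod _ hFs.aemeasurable]
  have h2 : ∀ y : Fin m → ℝ, ∫⁻ s, F (Fin.snoc (α := fun _ => ℝ) y s) =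
      ∫⁻ s, F (Fin.snoc (α := fun _ => ℝ) y (s - ∑ i, y i)) := fun y =>
    (lintegral_sub_right_eq_self (fun s => F (Fin.snoc (α := fun _ => ℝ) y s)) _).symm
  simp only [h2]
  have hm : Measurable fun z : (Fin m → ℝ) × ℝ =>
      F (Fin.snoc (α := fun _ => ℝ) z.1 (z.2 - ∑ i, z.1 i)) :=
    hF.comp (hsn.comp (measurable_fst.prodMk (by fun_prop)))
  rw [lintegral_lintegral_swap (f := fun y s =>
    F (Fin.snoc (α := fun _ => ℝ) y (s - ∑ i, y i))) hm.aemeasurable,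
    ← lintegral_indicator measurableSet_Ioi]
  refine lintegral_congr fun s => ?_
  by_cases hs : 0 < s
  · rw [Set.indicator_of_mem (Set.mem_Ioi.2 hs), lintegral_eq_scale hs (F := fun y =>
      F (Fin.snoc (α := fun _ => ℝ) y (s - ∑ i, y i))) (hm.comp (by fun_prop :
        Measurable fun y : Fin m → ℝ => (y, s)))]
    congr 1
    refine lintegral_congr fun x => congrArg F (funext fun k => ?_)
    induction k using Fin.lastCases with
    | last => simp [completeSimplex, mul_sub, Finset.mul_sum]
    | cast k => simp [completeSimplex]
  · rw [Set.indicator_of_notMem (by simpa using hs)]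
    refine (lintegral_congr fun y => hF0 _ ?_).trans lintegral_zero
    -- If all coordinates were positive, so would be their sum, which is `s`.
    by_contra! h
    have h3 := Finset.sum_pos (fun k _ => h k) Finset.univ_nonempty
    rw [Fin.sum_univ_castSucc] at h3
    simp at h3
    exact hs h3

theorem sigmaFinite_stdGamma (a : ℝ) : SigmaFinite (volume.withDensity (stdGammaPDF a)) :=
  SigmaFinite.withDensity_of_ne_top (ae_of_all _ fun _ => ENNReal.ofReal_ne_top)

instance {m : ℕ} (α : Fin (m + 1) → ℝ) : SFinite (dirichletMeasure α) := by
  unfold dirichletMeasure; infer_instance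

/-- In the coordinates `y = s x` the product of the gamma densities factors into a function of `s`
and the Dirichlet density of `x`. -/
theorem gamma_prod_dirichlet {m : ℕ} {α : Fin (m + 1) → ℝ} (hα : ∀ k, 0 < α k) :
    MeasurePreserving (fun z : ℝ × (Fin (m + 1) → ℝ) => fun k => z.1 * z.2 k)
      ((ProbabilityTheory.gammaMeasure (∑ k, α k) 1).prod (dirichletMeasure α))
      (Measure.pi fun k => ProbabilityTheory.gammaMeasure (α k) 1) := by
  refine ⟨by fun_prop, Measure.ext_of_lintegral _ fun f hf => ?_⟩
  simp only [gammaMeasure_one_eq]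
  have := sigmaFinite_stdGamma
  have hprod : Measurable fun y : Fin (m + 1) → ℝ => ∏ k, stdGammaPDF (α k) (y k) :=
    Finset.measurable_prod _ fun k _ => (measurable_stdGammaPDF _).comp (measurable_pi_apply k)
  have hfm : Measurable fun z : ℝ × (Fin (m + 1) → ℝ) => f fun k => z.1 * z.2 k :=
    hf.comp (by fun_prop)
  rw [pi_withDensity volume _ fun k => measurable_stdGammaPDF _,
    lintegral_withDensity_eq_lintegral_mul _ hprod hf,
    lintegral_map hf (by fun_prop), ← volume_pi,
    lintegral_simplex_coordinates (hprod.mul hf), lintegral_prod _ hfm.aemeasurable,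
    lintegral_withDensity_eq_lintegral_mul _ (measurable_stdGammaPDF _)
      (hfm.lintegral_prod_right' (ν := dirichletMeasure α)),
    ← lintegral_indicator measurableSet_Ioi]
  · refine lintegral_congr fun s => ?_
    by_cases hs : 0 < s
    · have hfs : Measurable fun y : Fin (m + 1) → ℝ => f fun k => s * y k := hf.comp (by fun_prop)
      have hfc : Measurable fun x : Fin m → ℝ => f fun k => s * completeSimplex x k :=
        hfs.comp measurable_completeSimplex
      have hd : Measurable fun x : Fin m → ℝ =>
          ENNReal.ofReal (dirichletPDF α (completeSimplex x)) :=
        ((measurable_dirichletPDF α).comp measurable_completeSimplex).ennreal_ofReal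
      rw [Set.indicator_of_mem (Set.mem_Ioi.2 hs), Pi.mul_apply, dirichletMeasure]
      dsimp only
      rw [lintegral_map hfs measurable_completeSimplex,
        lintegral_withDensity_eq_lintegral_mul _ hd hfc,
        ← lintegral_indicator measurableSet_openSimplex,
        ← lintegral_const_mul _ ?_, ← lintegral_const_mul _ ?_]
      · refine lintegral_congr fun x => ?_
        rw [Pi.mul_apply, ← mul_assoc, prod_stdGammaPDF hα hs, mul_assoc]
        exact congrArg _ (Set.indicator_mul_left _ _ _)
      · exact (hprod.mul hf).comp
          ((by fun_prop : Measurable fun y : Fin (m + 1) → ℝ => fun k => s * y k).comp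
            measurable_completeSimplex)
      · refine Measurable.indicator ?_ measurableSet_openSimplex
        exact hd.mul hfc
    · rw [Set.indicator_of_notMem (by simpa using hs), Pi.mul_apply, stdGammaPDF, if_neg hs]
      simp
  · rintro y ⟨k, hk⟩
    rw [Pi.mul_apply, Finset.prod_eq_zero (Finset.mem_univ k), zero_mul]
    rw [stdGammaPDF, if_neg hk.not_gt, ENNReal.ofReal_zero]

/-- The normalisation needs no separate integral: compare total masses in `gamma_prod_dirichlet`. -/
theorem isProbabilityMeasure_dirichlet {m : ℕ} {α : Fin (m + 1) → ℝ} (hα : ∀ k, 0 < α k) :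
    IsProbabilityMeasure (dirichletMeasure α) := by
  have : IsProbabilityMeasure (ProbabilityTheory.gammaMeasure (∑ k, α k) 1) := ProbabilityTheory.isProbabilityMeasure_gammaMeasure
    (Finset.sum_pos (fun k _ => hα k) Finset.univ_nonempty) zero_lt_one
  have h := (gamma_prod_dirichlet hα).measure_preimage (MeasurableSet.univ.nullMeasurableSet)
  have := fun k => ProbabilityTheory.isProbabilityMeasure_gammaMeasure (hα k) zero_lt_one
  rw [Set.preimage_univ, ← Set.univ_prod_univ, Measure.prod_prod, measure_univ, one_mul] at h
  exact ⟨h.trans measure_univ⟩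

theorem dirichlet_ae_mem {m : ℕ} (α : Fin (m + 1) → ℝ) :
    ∀ᵐ x ∂dirichletMeasure α, (∀ k, 0 < x k) ∧ x ∈ stdSimplex ℝ (Fin (m + 1)) := by
  have h : ∀ᵐ x ∂(((volume : Measure (Fin m → ℝ)).restrict
      {x | (∀ i, 0 < x i) ∧ ∑ i, x i < 1}).withDensity
        fun x => ENNReal.ofReal (dirichletPDF α (completeSimplex x))),
      (∀ k, 0 < completeSimplex x k) ∧ completeSimplex x ∈ stdSimplex ℝ (Fin (m + 1)) := by
    refine (withDensity_absolutelyContinuous _ _).ae_le ?_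
    filter_upwards [ae_restrict_mem measurableSet_openSimplex] with x hx
    have := (completeSimplex_pos_iff x).2 hx
    exact ⟨this, fun k => (this k).le, sum_completeSimplex x⟩
  refine (ae_map_iff measurable_completeSimplex.aemeasurable ?_).2 h
  have h1 := MeasurableSet.univ_pi
    fun _ : Fin (m + 1) => (measurableSet_Ioi : MeasurableSet (Set.Ioi (0 : ℝ)))
  convert h1.inter (isClosed_stdSimplex ℝ (Fin (m + 1))).measurableSet using 1
  ext x
  simp [Set.mem_pi]

/-! ### Exponential variables on the leaves of a tree -/

theorem weight_pos (t : DTree) (j : t.Node) (k : Fin (t.extra j + 2)) : 0 < t.weight j k := by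
  induction t with
  | leaf => exact j.elim
  | node n c ih =>
    rcases j with ⟨⟩ | ⟨i, j⟩
    · exact Fintype.card_pos_iff.2 ⟨(c k).out⟩
    · exact ih i j k

theorem weight_cast_pos (t : DTree) (j : t.Node) (k : Fin (t.extra j + 2)) :
    (0 : ℝ) < t.weight j k :=
  Nat.cast_pos.2 (weight_pos t j k)

theorem card_leaf_pos (t : DTree) : (0 : ℝ) < Fintype.card t.Leaf :=
  Nat.cast_pos.2 (Fintype.card_pos_iff.2 ⟨t.out⟩)

/-- The product of the Dirichlet distributions of the nodes of a tree. -/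
noncomputable def nodesMeasure (t : DTree) : Measure ((j : t.Node) → Fin (t.extra j + 2) → ℝ) :=
  Measure.pi fun j => dirichletMeasure fun k => (t.weight j k : ℝ)

instance (t : DTree) (j : t.Node) :
    IsProbabilityMeasure (dirichletMeasure fun k => (t.weight j k : ℝ)) :=
  isProbabilityMeasure_dirichlet (weight_cast_pos t j)

instance isProbabilityMeasure_nodesMeasure (t : DTree) : IsProbabilityMeasure (nodesMeasure t) := by
  unfold nodesMeasure; infer_instance

instance (t : DTree) : IsProbabilityMeasure
    (ProbabilityTheory.gammaMeasure (Fintype.card t.Leaf : ℝ) 1) :=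
  ProbabilityTheory.isProbabilityMeasure_gammaMeasure (card_leaf_pos t) zero_lt_one

instance : IsProbabilityMeasure (ProbabilityTheory.gammaMeasure 1 1) :=
  ProbabilityTheory.isProbabilityMeasure_gammaMeasure zero_lt_one zero_lt_one

/-- At the root, a Gamma variable whose shape is the number of leaves and the Dirichlet vector of
the root produce independent Gamma variables whose shapes are the leaf numbers of the subtrees. This
is just the input of the induction hypothesis in each subtree; a single leaf is left with Gamma(1),
the exponential distribution. -/
theorem gamma_prod_nodesMeasure (t : DTree) :
    MeasurePreserving (fun z : ℝ × ((j : t.Node) → Fin (t.extra j + 2) → ℝ) =>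
        fun l : t.Leaf => z.1 * leafProb t z.2 l)
      ((ProbabilityTheory.gammaMeasure (Fintype.card t.Leaf : ℝ) 1).prod (nodesMeasure t))
      (Measure.pi fun _ => ProbabilityTheory.gammaMeasure 1 1) := by
  induction t with
  | leaf =>
    have h0 : ((Fintype.card DTree.leaf.Leaf : ℕ) : ℝ) = 1 := by
      change ((Fintype.card Unit : ℕ) : ℝ) = 1
      simp
    have h1 : MeasurePreserving
      (Prod.fst : ℝ × ((j : DTree.leaf.Node) → Fin (DTree.leaf.extra j + 2) → ℝ) → ℝ)
      ((ProbabilityTheory.gammaMeasure (Fintype.card DTree.leaf.Leaf : ℝ) 1).prod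
        (nodesMeasure .leaf)) (ProbabilityTheory.gammaMeasure 1 1) := by
      have := isProbabilityMeasure_nodesMeasure .leaf
      rw [h0]
      exact measurePreserving_fst
    have h2 := (measurePreserving_funUnique (ProbabilityTheory.gammaMeasure 1 1) Unit).symm
    convert h2.comp h1 using 1
    funext z l
    exact mul_one _
  | node k c ih =>
    have hcard : ((Fintype.card (DTree.node k c).Leaf : ℕ) : ℝ) =
        ∑ i, (Fintype.card (c i).Leaf : ℝ) := by
      rw [← Nat.cast_sum]
      exact congrArg Nat.cast (Fintype.card_sigma (α := fun i => (c i).Leaf))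
    have hsplit : MeasurePreserving (fun x : (j : (DTree.node k c).Node) →
        Fin ((DTree.node k c).extra j + 2) → ℝ =>
          (x (Sum.inl ()), fun i (j : (c i).Node) => x (Sum.inr ⟨i, j⟩)))
        (nodesMeasure (.node k c))
        ((dirichletMeasure fun i => (Fintype.card (c i).Leaf : ℝ)).prod
          (Measure.pi fun i => nodesMeasure (c i))) :=
      ⟨(measurable_pi_apply _).prodMk (measurable_pi_iff.2 fun i => measurable_childParams c i),
        pi_node_map c _⟩
    have hzip := prod_pi_map_zip
      (fun i => ProbabilityTheory.gammaMeasure (Fintype.card (c i).Leaf : ℝ) 1)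
      (fun i => nodesMeasure (c i))
    have : IsProbabilityMeasure (ProbabilityTheory.gammaMeasure
        (∑ i, (Fintype.card (c i).Leaf : ℝ)) 1) :=
      ProbabilityTheory.isProbabilityMeasure_gammaMeasure
        (Finset.sum_pos (fun i _ => card_leaf_pos (c i)) Finset.univ_nonempty) zero_lt_one
    have := isProbabilityMeasure_dirichlet fun i => card_leaf_pos (c i)
    have := isProbabilityMeasure_nodesMeasure (.node k c)
    -- The chain `e1`, …, `e6`: split off the root, group its vector with the Gamma variable,
    -- multiply them, hand each subtree its own Gamma variable, apply the induction hypothesis, and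
    -- flatten the leaves.
    have e1 := (MeasurePreserving.id (ProbabilityTheory.gammaMeasure
      (∑ i, (Fintype.card (c i).Leaf : ℝ)) 1)).prod hsplit
    have e2 := (measurePreserving_prodAssoc (ProbabilityTheory.gammaMeasure
      (∑ i, (Fintype.card (c i).Leaf : ℝ)) 1)
      (dirichletMeasure fun i => (Fintype.card (c i).Leaf : ℝ))
      (Measure.pi fun i => nodesMeasure (c i))).symm
    have e3 := (gamma_prod_dirichlet fun i => card_leaf_pos (c i)).prod
      (MeasurePreserving.id (Measure.pi fun i => nodesMeasure (c i)))
    have e4 := MeasurePreserving.mk (by fun_prop) hzip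
    have e5 := measurePreserving_pi _ _ ih
    have e6 := MeasurePreserving.mk (by fun_prop) (pi_leaf_map c (ProbabilityTheory.gammaMeasure 1 1))
    rw [hcard]
    convert e6.comp (e5.comp (e4.comp (e3.comp (e2.comp e1)))) using 1
    funext z l
    exact (mul_assoc _ _ _).symm

/-! ### Complex Gaussian vectors -/

instance : IsProbabilityMeasure phaseMeasure := by
  constructor
  have := Real.two_pi_pos
  rw [phaseMeasure, Measure.smul_apply, Measure.restrict_apply_univ, Real.volume_Ico, smul_eq_mul,
    ← ENNReal.ofReal_mul (by positivity), sub_zero, one_div, inv_mul_cancel₀ this.ne',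
    ENNReal.ofReal_one]

theorem phaseMeasure_ae_mem : ∀ᵐ φ ∂phaseMeasure, φ ∈ Set.Ico 0 (2 * Real.pi) :=
  Measure.ae_smul_measure (ae_restrict_mem measurableSet_Ico) _

/-- The standard complex Gaussian distribution. -/
noncomputable def complexGaussian : Measure ℂ :=
  volume.withDensity fun z => ENNReal.ofReal (Real.exp (-‖z‖ ^ 2) / Real.pi)

/-- By periodicity the phases may run over `(-π, π)`, the range of the angle in polar coordinates,
and a reflection removes the sign. -/
theorem lintegral_phaseMeasure (f : ℂ → ℝ≥0∞) (r : ℝ) :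
    ∫⁻ φ, f (r * Complex.exp (-(φ * Complex.I))) ∂phaseMeasure =
      ENNReal.ofReal (1 / (2 * Real.pi)) *
        ∫⁻ θ in Set.Ioo (-Real.pi) Real.pi, f (r * Complex.exp (θ * Complex.I)) := by
  rw [phaseMeasure, lintegral_smul_measure, smul_eq_mul]
  congr 1
  -- Intervals of length `2π` are fundamental domains for the translations by `2πℤ`, under which `g`
  -- is invariant.
  set g : ℝ → ℝ≥0∞ := fun φ => f (r * Complex.exp (-(φ * Complex.I))) with hg
  have hper : ∀ (k : AddSubgroup.zmultiples (2 * Real.pi)) (x : ℝ), g (k +ᵥ x) = g x := by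
    rintro ⟨_, n, rfl⟩ x
    simp only [hg]
    congr 2
    rw [Complex.exp_eq_exp_iff_exists_int]
    refine ⟨-n, ?_⟩
    simp [AddSubgroup.vadd_def]
    ring
  have h1 : ∫⁻ φ in Set.Ico 0 (2 * Real.pi), g φ = ∫⁻ φ in Set.Ioc (-Real.pi) Real.pi, g φ := by
    have h2 := isAddFundamentalDomain_Ioc Real.two_pi_pos 0 volume
    have h3 := isAddFundamentalDomain_Ioc Real.two_pi_pos (-Real.pi) volume
    rw [show (0 : ℝ) + 2 * Real.pi = 2 * Real.pi by ring] at h2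
    rw [show -Real.pi + 2 * Real.pi = Real.pi by ring] at h3
    rw [setLIntegral_congr Ico_ae_eq_Ioc]
    exact h2.setLIntegral_eq h3 g hper
  rw [h1, ← setLIntegral_congr Ioo_ae_eq_Ioc]
  have h4 : ∀ θ : ℝ, f (r * Complex.exp (θ * Complex.I)) = g (-θ) := by
    intro θ
    simp [hg]
  simp only [h4]
  rw [← lintegral_indicator measurableSet_Ioo, ← lintegral_indicator measurableSet_Ioo,
    ← lintegral_neg_eq_self]
  refine lintegral_congr fun θ => ?_
  by_cases hθ : θ ∈ Set.Ioo (-Real.pi) Real.pi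
  · rw [Set.indicator_of_mem hθ, Set.indicator_of_mem
      (Set.mem_Ioo.2 ⟨by linarith [hθ.2], by linarith [hθ.1]⟩)]
  · rw [Set.indicator_of_notMem hθ, Set.indicator_of_notMem fun h => hθ
      (Set.mem_Ioo.2 ⟨by linarith [h.2], by linarith [h.1]⟩)]

theorem lintegral_Ioi_sq (g : ℝ → ℝ≥0∞) :
    ∫⁻ s in Set.Ioi (0 : ℝ), g s = ∫⁻ r in Set.Ioi (0 : ℝ), ENNReal.ofReal (2 * r) * g (r ^ 2) := by
  have himg : (fun r : ℝ => r ^ 2) '' Set.Ioi 0 = Set.Ioi 0 := by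
    ext s
    constructor
    · rintro ⟨r, hr, rfl⟩
      exact pow_pos (Set.mem_Ioi.1 hr) 2
    · intro hs
      exact ⟨√s, Real.sqrt_pos.2 hs, Real.sq_sqrt (le_of_lt hs)⟩
  have h := lintegral_image_eq_lintegral_abs_deriv_mul (s := Set.Ioi (0 : ℝ))
    (f := fun r => r ^ 2) (f' := fun r => 2 * r) measurableSet_Ioi
    (fun x _ => by simpa using (hasDerivAt_pow 2 x).hasDerivWithinAt)
    (fun a ha b hb hab => by
      exact (sq_eq_sq₀ (le_of_lt ha) (le_of_lt hb)).1 hab) g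
  rw [himg] at h
  rw [h]
  refine setLIntegral_congr_fun measurableSet_Ioi fun r hr => ?_
  rw [abs_of_pos (mul_pos two_pos hr)]

/-- With `s = r²`, the measure `exp (-s) ds dφ / 2π` becomes `exp (-r²) r dr dφ / π`, the Gaussian
in polar coordinates. -/
theorem exponential_prod_phase :
    MeasurePreserving (fun z : ℝ × ℝ => (√z.1 : ℂ) * Complex.exp (-(z.2 * Complex.I)))
      ((ProbabilityTheory.gammaMeasure 1 1).prod phaseMeasure) complexGaussian := by
  have hm : Measurable fun z : ℝ × ℝ => (√z.1 : ℂ) * Complex.exp (-(z.2 * Complex.I)) := by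
    fun_prop
  refine ⟨hm, Measure.ext_of_lintegral _ fun f hf => ?_⟩
  have hfm : Measurable fun z : ℝ × ℝ => f ((√z.1 : ℂ) * Complex.exp (-(z.2 * Complex.I))) :=
    hf.comp hm
  have hdens : Measurable fun z : ℂ => ENNReal.ofReal (Real.exp (-‖z‖ ^ 2) / Real.pi) := by
    fun_prop
  rw [lintegral_map hf hm, lintegral_prod _ hfm.aemeasurable, complexGaussian,
    lintegral_withDensity_eq_lintegral_mul _ hdens hf, ← Complex.lintegral_comp_polarCoord_symm,
    polarCoord_target, Measure.volume_eq_prod, ← Measure.prod_restrict]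
  have hpol : Measurable fun p : ℝ × ℝ => ENNReal.ofReal p.1 •
      ((fun z : ℂ => ENNReal.ofReal (Real.exp (-‖z‖ ^ 2) / Real.pi)) * f)
        (Complex.polarCoord.symm p) := by
    simp only [Complex.polarCoord_symm_apply]
    exact (by fun_prop : Measurable fun p : ℝ × ℝ => ENNReal.ofReal p.1).smul
      ((hdens.mul hf).comp (by fun_prop))
  rw [lintegral_prod _ hpol.aemeasurable, gammaMeasure_one_eq,
    lintegral_withDensity_eq_lintegral_mul _ (measurable_stdGammaPDF 1)
      (hfm.lintegral_prod_right' (ν := phaseMeasure))]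
  have h1 : ∀ s : ℝ, (stdGammaPDF 1 * fun s => ∫⁻ φ, f ((√(s, φ).1 : ℂ) *
      Complex.exp (-((s, φ).2 * Complex.I))) ∂phaseMeasure) s =
      (Set.Ioi (0 : ℝ)).indicator (fun s => ENNReal.ofReal (Real.exp (-s)) *
        (ENNReal.ofReal (1 / (2 * Real.pi)) *
        ∫⁻ θ in Set.Ioo (-Real.pi) Real.pi, f (√s * Complex.exp (θ * Complex.I)))) s := by
    intro s
    by_cases hs : 0 < s
    · rw [Set.indicator_of_mem (Set.mem_Ioi.2 hs), Pi.mul_apply, stdGammaPDF, if_pos hs]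
      dsimp only
      rw [lintegral_phaseMeasure f]
      simp
    · rw [Set.indicator_of_notMem (by simpa using hs), Pi.mul_apply, stdGammaPDF, if_neg hs]
      simp
  simp only [h1]
  rw [lintegral_indicator measurableSet_Ioi, lintegral_Ioi_sq]
  refine setLIntegral_congr_fun measurableSet_Ioi fun r hr => ?_
  have hr0 : (0 : ℝ) < r := hr
  have h2 : ∀ θ : ℝ, (Complex.polarCoord.symm (r, θ) : ℂ) = r * Complex.exp (θ * Complex.I) := by
    intro θ
    rw [Complex.polarCoord_symm_apply, Complex.exp_mul_I, Complex.ofReal_cos, Complex.ofReal_sin]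
  have h3 : ∀ θ : ℝ, ‖(r : ℂ) * Complex.exp (θ * Complex.I)‖ = r := by
    intro θ
    rw [norm_mul, Complex.norm_exp_ofReal_mul_I, mul_one, Complex.norm_real,
      Real.norm_of_nonneg hr0.le]
  simp only [h2, Pi.mul_apply, h3, smul_eq_mul, Real.sqrt_sq hr0.le]
  have hfr : Measurable fun θ : ℝ => f (r * Complex.exp (θ * Complex.I)) :=
    hf.comp (by fun_prop)
  rw [lintegral_const_mul _ (hfr.const_mul _), lintegral_const_mul _ hfr, ← mul_assoc,
    ← mul_assoc, ← mul_assoc, ← ENNReal.ofReal_mul (by positivity),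
    ← ENNReal.ofReal_mul (by positivity), ← ENNReal.ofReal_mul (by positivity)]
  congr 2
  field_simp

instance : IsProbabilityMeasure complexGaussian := by
  rw [← exponential_prod_phase.map_eq]
  exact Measure.isProbabilityMeasure_map exponential_prod_phase.measurable.aemeasurable

theorem vecMul_norm_sq {n : ℕ} {W : Matrix (Fin n) (Fin n) ℂ}
    (hW : W ∈ Matrix.unitaryGroup (Fin n) ℂ) (v : Fin n → ℂ) :
    ∑ i, ‖Matrix.vecMul v W i‖ ^ 2 = ∑ i, ‖v i‖ ^ 2 := by
  have h : ∀ u : Fin n → ℂ, ((∑ i, ‖u i‖ ^ 2 : ℝ) : ℂ) = u ⬝ᵥ star u := by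
    intro u
    rw [dotProduct]
    push_cast
    exact Finset.sum_congr rfl fun i _ => (Complex.mul_conj' _).symm
  have h2 : ((∑ i, ‖Matrix.vecMul v W i‖ ^ 2 : ℝ) : ℂ) = ((∑ i, ‖v i‖ ^ 2 : ℝ) : ℂ) := by
    rw [h, h, Matrix.star_vecMul, ← Matrix.dotProduct_mulVec, Matrix.mulVec_mulVec,
      ← Matrix.star_eq_conjTranspose, (Matrix.mem_unitaryGroup_iff).1 hW, Matrix.one_mulVec]
  exact_mod_cast h2

theorem measurable_vecMul {n : ℕ} (W : Matrix (Fin n) (Fin n) ℂ) :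
    Measurable fun v : Fin n → ℂ => Matrix.vecMul v W := by
  refine measurable_pi_iff.2 fun i => ?_
  simp only [Matrix.vecMul, dotProduct]
  fun_prop

/-- The Gaussian density depends only on `∑ ‖v i‖²`, which a unitary matrix preserves. Lebesgue
measure is multiplied by a constant `c`, by uniqueness of Haar measure; comparing total Gaussian
masses gives `c = 1` without a determinant. -/
theorem gaussian_vecMul {n : ℕ} {W : Matrix (Fin n) (Fin n) ℂ}
    (hW : W ∈ Matrix.unitaryGroup (Fin n) ℂ) :
    MeasurePreserving (fun v : Fin n → ℂ => Matrix.vecMul v W)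
      (Measure.pi fun _ => complexGaussian) (Measure.pi fun _ => complexGaussian) := by
  refine ⟨measurable_vecMul W, ?_⟩
  have hdens : Measurable fun z : ℂ => ENNReal.ofReal (Real.exp (-‖z‖ ^ 2) / Real.pi) := by
    fun_prop
  set h : (Fin n → ℂ) → ℝ≥0∞ := fun v => ∏ i, ENNReal.ofReal (Real.exp (-‖v i‖ ^ 2) / Real.pi)
    with hh
  have hhm : Measurable h :=
    Finset.measurable_prod _ fun i _ => hdens.comp (measurable_pi_apply i)
  have hpi : (Measure.pi fun _ : Fin n => complexGaussian) =
      (volume : Measure (Fin n → ℂ)).withDensity h := by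
    have : ∀ _ : Fin n, SigmaFinite ((volume : Measure ℂ).withDensity fun z =>
        ENNReal.ofReal (Real.exp (-‖z‖ ^ 2) / Real.pi)) := fun _ =>
      SigmaFinite.withDensity_of_ne_top (ae_of_all _ fun _ => ENNReal.ofReal_ne_top)
    exact pi_withDensity volume (fun (_ : Fin n) (z : ℂ) =>
      ENNReal.ofReal (Real.exp (-‖z‖ ^ 2) / Real.pi)) fun _ => hdens
  have hinv : ∀ v, h (Matrix.vecMul v W) = h v := by
    intro v
    simp only [hh]
    rw [← ENNReal.ofReal_prod_of_nonneg fun i _ => by positivity,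
      ← ENNReal.ofReal_prod_of_nonneg fun i _ => by positivity, Finset.prod_div_distrib,
      Finset.prod_div_distrib, ← Real.exp_sum, ← Real.exp_sum, Finset.sum_neg_distrib,
      Finset.sum_neg_distrib, vecMul_norm_sq hW]
  let L : (Fin n → ℂ) ≃ₗ[ℂ] (Fin n → ℂ) :=
    LinearEquiv.ofLinearMap (Matrix.vecMulLinear W) (Matrix.vecMulLinear (star W))
      (LinearMap.ext fun v => by
        change Matrix.vecMul (Matrix.vecMul v (star W)) W = v
        rw [Matrix.vecMul_vecMul, (Matrix.mem_unitaryGroup_iff').1 hW, Matrix.vecMul_one])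
      (LinearMap.ext fun v => by
        change Matrix.vecMul (Matrix.vecMul v W) (star W) = v
        rw [Matrix.vecMul_vecMul, (Matrix.mem_unitaryGroup_iff).1 hW, Matrix.vecMul_one])
  have hhaar := L.toContinuousLinearEquiv.isAddHaarMeasure_map (volume : Measure (Fin n → ℂ))
  obtain ⟨c, hc⟩ : ∃ c : ℝ≥0∞, (volume : Measure (Fin n → ℂ)).map
      (fun v => Matrix.vecMul v W) = c • volume :=
    ⟨_, Measure.isAddLeftInvariant_eq_smul ((volume : Measure (Fin n → ℂ)).map
      L.toContinuousLinearEquiv) volume⟩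
  have hmap : (Measure.pi fun _ : Fin n => complexGaussian).map
      (fun v => Matrix.vecMul v W) = c • Measure.pi fun _ : Fin n => complexGaussian := by
    rw [hpi]
    refine Measure.ext_of_lintegral _ fun f hf => ?_
    have hfW : Measurable fun v => f (Matrix.vecMul v W) := hf.comp (measurable_vecMul W)
    rw [lintegral_map hf (measurable_vecMul W), lintegral_withDensity_eq_lintegral_mul _ hhm hfW,
      lintegral_smul_measure, lintegral_withDensity_eq_lintegral_mul _ hhm hf,
      ← lintegral_smul_measure, ← hc, lintegral_map (hhm.mul hf) (measurable_vecMul W)]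
    refine lintegral_congr fun v => ?_
    simp [hinv]
  have hc1 : c = 1 := by
    have h1 := congrArg (fun μ => μ Set.univ) hmap
    simp only [Measure.map_apply (measurable_vecMul W) MeasurableSet.univ, Set.preimage_univ,
      Measure.smul_apply, measure_univ, smul_eq_mul, mul_one] at h1
    exact h1.symm
  rw [hmap, hc1, one_smul]

/-! ### The distribution of the last row -/

section RowLaw

variable {m : ℕ} (G : LabelledTree m)

instance : IsProbabilityMeasure (rotationMeasure G) := by
  unfold rotationMeasure; infer_instance

theorem rotationMeasure_ae_mem :
    ∀ᵐ p ∂rotationMeasure G, (∀ i, p.1 i ∈ Set.Ico 0 (2 * Real.pi)) ∧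
      ∀ j, (∀ k, 0 < p.2 j k) ∧ p.2 j ∈ stdSimplex ℝ (Fin (G.tree.extra j + 2)) := by
  have h1 : ∀ᵐ φ ∂(Measure.pi fun _ : Fin (m + 1) => phaseMeasure),
      ∀ i, φ i ∈ Set.Ico 0 (2 * Real.pi) := by
    rw [ae_all_iff]
    intro i
    exact (measurePreserving_eval _ i).quasiMeasurePreserving.ae phaseMeasure_ae_mem
  have h2 : ∀ᵐ x ∂nodesMeasure G.tree, ∀ j, (∀ k, 0 < x j k) ∧
      x j ∈ stdSimplex ℝ (Fin (G.tree.extra j + 2)) := by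
    rw [ae_all_iff]
    intro j
    exact (measurePreserving_eval (fun j => dirichletMeasure fun k => (G.tree.weight j k : ℝ))
      j).quasiMeasurePreserving.ae (dirichlet_ae_mem _)
  have h3 : ∀ᵐ p ∂rotationMeasure G, ∀ i, p.1 i ∈ Set.Ico 0 (2 * Real.pi) :=
    Measure.quasiMeasurePreserving_fst.ae h1
  have h4 : ∀ᵐ p ∂rotationMeasure G, ∀ j, (∀ k, 0 < p.2 j k) ∧
      p.2 j ∈ stdSimplex ℝ (Fin (G.tree.extra j + 2)) :=
    Measure.quasiMeasurePreserving_snd.ae h2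
  filter_upwards [h3, h4] with p hp hp'
  exact ⟨hp, hp'⟩

theorem pi_map_reindex {ι κ X : Type*} [Fintype ι] [Fintype κ] [MeasurableSpace X] (e : ι ≃ κ)
    (μ : Measure X) [SigmaFinite μ] :
    MeasurePreserving (fun (x : ι → X) k => x (e.symm k)) (Measure.pi fun _ => μ)
      (Measure.pi fun _ => μ) := by
  refine ⟨by fun_prop, (Measure.pi_eq fun s hs => ?_).symm⟩
  rw [Measure.map_apply (by fun_prop) (MeasurableSet.univ_pi hs)]
  have : (fun (x : ι → X) k => x (e.symm k)) ⁻¹' Set.univ.pi s =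
      Set.univ.pi fun i => s (e i) := by
    ext x
    simp only [Set.mem_preimage, Set.mem_pi, Set.mem_univ, true_implies]
    exact ⟨fun h i => by simpa using h (e i), fun h k => by simpa using h (e.symm k)⟩
  rw [this, Measure.pi_pi]
  exact Equiv.prod_comp e fun k => μ (s k)

/-- Exponential variables on the leaves are relabelled by the input rails and paired with the
phases, giving one complex Gaussian per rail. The labelling is irrelevant because the variables are
identically distributed. -/
theorem gamma_prod_rotationMeasure :
    MeasurePreserving (fun z : ℝ × ((Fin (m + 1) → ℝ) ×
        ((j : G.tree.Node) → Fin (G.tree.extra j + 2) → ℝ)) =>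
        fun i => (√(z.1 * leafProb G.tree z.2.2 (G.input.symm i)) : ℂ) *
          Complex.exp (-(z.2.1 i * Complex.I)))
      ((ProbabilityTheory.gammaMeasure (Fintype.card G.tree.Leaf : ℝ) 1).prod (rotationMeasure G))
      (Measure.pi fun _ => complexGaussian) := by
  have : SFinite (Measure.pi fun _ : Fin (m + 1) => phaseMeasure) := inferInstance
  have : SFinite (nodesMeasure G.tree) := inferInstance
  have : SFinite ((Measure.pi fun _ : Fin (m + 1) => phaseMeasure).prod
    (nodesMeasure G.tree)) := Measure.prod.instSFinite
  have e1 := (MeasurePreserving.id (ProbabilityTheory.gammaMeasure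
    (Fintype.card G.tree.Leaf : ℝ) 1)).prod (Measure.measurePreserving_swap
      (μ := Measure.pi fun _ : Fin (m + 1) => phaseMeasure) (ν := nodesMeasure G.tree))
  have e2 := (measurePreserving_prodAssoc (ProbabilityTheory.gammaMeasure
    (Fintype.card G.tree.Leaf : ℝ) 1) (nodesMeasure G.tree)
      (Measure.pi fun _ : Fin (m + 1) => phaseMeasure)).symm
  have e3 := ((pi_map_reindex G.input (ProbabilityTheory.gammaMeasure 1 1)).comp
    (gamma_prod_nodesMeasure G.tree)).prod
      (MeasurePreserving.id (Measure.pi fun _ : Fin (m + 1) => phaseMeasure))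
  have e4 := MeasurePreserving.mk (by fun_prop) (prod_pi_map_zip
    (fun _ : Fin (m + 1) => ProbabilityTheory.gammaMeasure 1 1) fun _ => phaseMeasure)
  have e5 := measurePreserving_pi _ _ fun _ : Fin (m + 1) => exponential_prod_phase
  exact e5.comp (e4.comp (e3.comp (e2.comp e1)))

/-- The radial projection to the unit sphere. -/
noncomputable def normalise {n : ℕ} (v : Fin n → ℂ) : Fin n → ℂ :=
  fun i => v i / (√(∑ j, ‖v j‖ ^ 2) : ℝ)

theorem measurable_normalise {n : ℕ} : Measurable (normalise : (Fin n → ℂ) → Fin n → ℂ) := by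
  unfold normalise
  fun_prop

theorem normalise_vecMul {n : ℕ} {W : Matrix (Fin n) (Fin n) ℂ}
    (hW : W ∈ Matrix.unitaryGroup (Fin n) ℂ) (v : Fin n → ℂ) :
    normalise (Matrix.vecMul v W) = Matrix.vecMul (normalise v) W := by
  funext i
  simp only [normalise, vecMul_norm_sq hW]
  simp only [Matrix.vecMul, dotProduct, Finset.sum_div, normalise]
  refine Finset.sum_congr rfl fun j _ => ?_
  ring

theorem gammaMeasure_ae_pos (a : ℝ) : ∀ᵐ s ∂ProbabilityTheory.gammaMeasure a 1, 0 < s := by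
  rw [gammaMeasure_one_eq, ae_withDensity_iff (measurable_stdGammaPDF a)]
  refine ae_of_all _ fun s hs => ?_
  by_contra h
  exact hs (by rw [stdGammaPDF, if_neg h, ENNReal.ofReal_zero])

/-- The Gaussian vector is `√s` times the row vector, with `s` the Gamma variable. The row vector
has norm one almost surely, so the projection removes exactly `√s`. -/
theorem gaussian_map_normalise :
    MeasurePreserving normalise (Measure.pi fun _ : Fin (m + 1) => complexGaussian)
      ((rotationMeasure G).map (rowVec G)) := by
  refine ⟨measurable_normalise, ?_⟩
  rw [← (gamma_prod_rotationMeasure G).map_eq,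
    Measure.map_map measurable_normalise (gamma_prod_rotationMeasure G).measurable]
  have h1 : (rotationMeasure G).map (rowVec G) = ((ProbabilityTheory.gammaMeasure
      (Fintype.card G.tree.Leaf : ℝ) 1).prod (rotationMeasure G)).map (rowVec G ∘ Prod.snd) := by
    rw [← Measure.map_map (measurable_rowVec G) measurable_snd, measurePreserving_snd.map_eq]
  rw [h1]
  refine Measure.map_congr ?_
  filter_upwards [Measure.quasiMeasurePreserving_fst.ae (gammaMeasure_ae_pos _),
    Measure.quasiMeasurePreserving_snd.ae (rotationMeasure_ae_mem G)] with z hz hz'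
  have h2 : ∀ l, 0 ≤ leafProb G.tree z.2.2 l :=
    fun l => leafProb_nonneg _ _ (fun j => (hz'.2 j).2.1) l
  have h3 : (fun i => (√(z.1 * leafProb G.tree z.2.2 (G.input.symm i)) : ℂ) *
      Complex.exp (-(z.2.1 i * Complex.I))) = fun i => (√z.1 : ℂ) * rowVec G z.2 i := by
    funext i
    rw [rowVec, Real.sqrt_mul hz.le, Complex.ofReal_mul, mul_assoc]
  have h4 : ∑ i, ‖(√z.1 : ℂ) * rowVec G z.2 i‖ ^ 2 = z.1 := by
    have : ∀ i, ‖(√z.1 : ℂ) * rowVec G z.2 i‖ ^ 2 =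
        z.1 * leafProb G.tree z.2.2 (G.input.symm i) := by
      intro i
      rw [norm_mul, norm_rowVec, Complex.norm_real, Real.norm_of_nonneg (Real.sqrt_nonneg _),
        mul_pow, Real.sq_sqrt hz.le, Real.sq_sqrt (h2 _)]
    simp only [this]
    rw [← Finset.mul_sum, Equiv.sum_comp G.input.symm (leafProb G.tree z.2.2),
      sum_leafProb _ _ fun j => (hz'.2 j).2.2, mul_one]
  simp only [Function.comp_apply]
  rw [h3]
  funext i
  rw [normalise, h4, mul_div_cancel_left₀]
  exact_mod_cast (Real.sqrt_pos.2 hz).ne'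

/-- The radial projection commutes with unitary matrices, so invariance passes from the Gaussian law
to its image. -/
theorem rowLaw_vecMul {W : Matrix (Fin (m + 1)) (Fin (m + 1)) ℂ}
    (hW : W ∈ Matrix.unitaryGroup (Fin (m + 1)) ℂ) :
    MeasurePreserving (fun v => Matrix.vecMul v W) ((rotationMeasure G).map (rowVec G))
      ((rotationMeasure G).map (rowVec G)) :=
  (gaussian_map_normalise G).of_semiconj (gaussian_vecMul hW) (normalise_vecMul hW)
    (measurable_vecMul W)

end RowLaw

/-! ### The Haar measure of the unitary group -/

section Haar

variable {N : ℕ}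

instance : SecondCountableTopology (Matrix (Fin N) (Fin N) ℂ) :=
  inferInstanceAs (SecondCountableTopology (Fin N → Fin N → ℂ))

instance : StandardBorelSpace (Matrix (Fin N) (Fin N) ℂ) :=
  inferInstanceAs (StandardBorelSpace (Fin N → Fin N → ℂ))

theorem measurableSet_unitaryGroup :
    MeasurableSet {U : Matrix (Fin N) (Fin N) ℂ | U ∈ Matrix.unitaryGroup (Fin N) ℂ} :=
  (isClosed_unitary (R := Matrix (Fin N) (Fin N) ℂ)).measurableSet

instance : StandardBorelSpace (Matrix.unitaryGroup (Fin N) ℂ) :=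
  measurableSet_unitaryGroup.standardBorel

instance : SecondCountableTopology (Matrix.unitaryGroup (Fin N) ℂ) :=
  TopologicalSpace.Subtype.secondCountableTopology _

theorem measurable_last_row :
    Measurable fun (U : Matrix (Fin (N + 1)) (Fin (N + 1)) ℂ) i => U (Fin.last N) i :=
  measurable_pi_iff.2 fun i => measurable_matrix_apply measurable_id _ i

instance : (haarU N).IsHaarMeasure := by unfold haarU; infer_instance

instance : IsProbabilityMeasure (haarU N) := ⟨Measure.haarMeasure_self⟩

instance : (haarU N).IsMulRightInvariant := by
  refine ⟨fun g => ?_⟩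
  have : IsProbabilityMeasure ((haarU N).map (· * g)) :=
    Measure.isProbabilityMeasure_map (measurable_mul_const g).aemeasurable
  exact Measure.isHaarMeasure_eq_of_isProbabilityMeasure _ _

/-- The embedding of `U(N)` into `U(N + 1)`, acting on the first `N` coordinates. -/
def embedUnitary (V : Matrix.unitaryGroup (Fin N) ℂ) : Matrix.unitaryGroup (Fin (N + 1)) ℂ :=
  ⟨embed Fin.castSuccEmb V.1, embed_mem_unitary _ V.2⟩

theorem embedUnitary_mul (V W : Matrix.unitaryGroup (Fin N) ℂ) :
    embedUnitary (V * W) = embedUnitary V * embedUnitary W :=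
  Subtype.ext (embed_mul _ _ _)

theorem measurable_embedUnitary : Measurable (embedUnitary (N := N)) :=
  ((measurable_embed _).comp measurable_subtype_coe).subtype_mk

/-- The last row of a unitary matrix. -/
def lastRow (U : Matrix.unitaryGroup (Fin (N + 1)) ℂ) : Fin (N + 1) → ℂ := U.1 (Fin.last N)

theorem measurable_lastRow : Measurable (lastRow (N := N)) :=
  (measurable_pi_apply (Fin.last N)).comp measurable_subtype_coe

/-- A measurable function that is constant on the fibres of `L` is a measurable function of `L`. The
measurability of the factor is the substantial point: it rests on the standard Borel structure of
`X` and on `L` being surjective onto its range, which is why the range replaces `Z`. -/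
theorem lintegral_eq_of_map_eq {X Z : Type*} [MeasurableSpace X] [StandardBorelSpace X]
    [MeasurableSpace Z] [MeasurableSpace.CountablySeparated Z] {L : X → Z} (hL : Measurable L)
    {μ ν : Measure X} (h : μ.map L = ν.map L) {Φ : X → ℝ≥0∞} (hΦ : Measurable Φ)
    (hc : ∀ x y, L x = L y → Φ x = Φ y) : ∫⁻ x, Φ x ∂μ = ∫⁻ x, Φ x ∂ν := by
  set L' : X → Set.range L := Set.rangeFactorization L with hL'
  have : MeasurableSpace.CountablySeparated (Set.range L) :=
    MeasurableSpace.Subtype.countablySeparated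
  have hLm : Measurable L' := hL.subtype_mk
  obtain ⟨g, hg⟩ : ∃ g : Set.range L → ℝ≥0∞, Φ = g ∘ L' := by
    refine ⟨fun z => Φ z.2.choose, funext fun x => hc _ _ ?_⟩
    exact (L' x).2.choose_spec.symm
  have hgm : Measurable g :=
    (hLm.measurable_comp_iff_of_surjective Set.rangeFactorization_surjective).1 (hg ▸ hΦ)
  have hmap : μ.map L' = ν.map L' := by
    ext s hs
    obtain ⟨B, hB, rfl⟩ := hs
    have h1 := congrArg (fun ρ => ρ B) h
    simp only [Measure.map_apply hL hB] at h1
    rw [Measure.map_apply hLm (measurable_subtype_coe hB),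
      Measure.map_apply hLm (measurable_subtype_coe hB)]
    exact h1
  simp only [hg, Function.comp_apply]
  rw [← lintegral_map hgm hLm, hmap, lintegral_map hgm hLm]

/-- There is only one invariant law of the row: averaging the invariance over a Haar distributed `W`
and exchanging integrals gives the integral of `f (lastRow (U * W))` over `W`, which left invariance
frees from `U`. -/
theorem map_lastRow_eq (ρ : Measure (Matrix.unitaryGroup (Fin (N + 1)) ℂ)) [IsProbabilityMeasure ρ]
    (hρ : ∀ W : Matrix.unitaryGroup (Fin (N + 1)) ℂ,
      (ρ.map lastRow).map (fun v => Matrix.vecMul v W.1) = ρ.map lastRow) :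
    ρ.map lastRow = (haarU (N + 1)).map lastRow := by
  refine Measure.ext_of_lintegral _ fun f hf => ?_
  have hfl : Measurable fun U => f (lastRow U) := hf.comp measurable_lastRow
  rw [lintegral_map hf measurable_lastRow, lintegral_map hf measurable_lastRow]
  have h1 : ∀ W, ∫⁻ U, f (lastRow U) ∂ρ = ∫⁻ U, f (lastRow (U * W)) ∂ρ := by
    intro W
    have hfW : Measurable fun v => f (Matrix.vecMul v W.1) := hf.comp (measurable_vecMul W.1)
    rw [← lintegral_map hf measurable_lastRow, ← hρ W, lintegral_map hf (measurable_vecMul W.1),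
      lintegral_map hfW measurable_lastRow]
    rfl
  have h2 : ∫⁻ U, f (lastRow U) ∂ρ =
      ∫⁻ W, ∫⁻ U, f (lastRow (U * W)) ∂ρ ∂(haarU (N + 1)) := by
    simp only [← h1]
    simp
  rw [h2, lintegral_lintegral_swap]
  · simp only [lintegral_mul_left_eq_self (μ := haarU (N + 1)) fun W => f (lastRow W)]
    simp
  · exact (hfl.comp (measurable_snd.mul measurable_fst)).aemeasurable

/-- Only the law of the last row under `ρ` matters, since averaging over `U(N)` makes the integrand
a function of that row. Once `ρ` is replaced by the Haar measure, left invariance absorbs the factor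
from `U(N)`. -/
theorem haarU_succ (ρ : Measure (Matrix.unitaryGroup (Fin (N + 1)) ℂ)) [IsProbabilityMeasure ρ]
    (hρ : ∀ W : Matrix.unitaryGroup (Fin (N + 1)) ℂ,
      (ρ.map lastRow).map (fun v => Matrix.vecMul v W.1) = ρ.map lastRow) :
    ((haarU N).prod ρ).map (fun z => embedUnitary z.1 * z.2) = haarU (N + 1) := by
  have hmul : Measurable fun z : Matrix.unitaryGroup (Fin N) ℂ ×
      Matrix.unitaryGroup (Fin (N + 1)) ℂ => embedUnitary z.1 * z.2 :=
    (measurable_embedUnitary.comp measurable_fst).mul measurable_snd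
  refine Measure.ext_of_lintegral _ fun f hf => ?_
  have hfm : Measurable fun z : Matrix.unitaryGroup (Fin N) ℂ ×
      Matrix.unitaryGroup (Fin (N + 1)) ℂ => f (embedUnitary z.1 * z.2) := hf.comp hmul
  rw [lintegral_map hf hmul, lintegral_prod_symm _ hfm.aemeasurable]
  rw [lintegral_eq_of_map_eq measurable_lastRow (map_lastRow_eq ρ hρ) hfm.lintegral_prod_left',
    lintegral_lintegral_swap]
  · simp only [lintegral_mul_left_eq_self (μ := haarU (N + 1)) f]
    simp
  · exact (hf.comp ((measurable_embedUnitary.comp measurable_snd).mul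
      measurable_fst)).aemeasurable
  -- Matrices with the same last row differ by a left factor `S` in `U(N)`, which right invariance
  -- of `haarU N` absorbs.
  · intro M M' h
    obtain ⟨S, hS, hSM⟩ := exists_eq_embed_mul M'.2 M.2 h.symm
    have hM' : M' = embedUnitary ⟨S, hS⟩ * M := Subtype.ext hSM
    simp only [hM', ← mul_assoc, ← embedUnitary_mul]
    exact (lintegral_mul_right_eq_self (μ := haarU N) (fun V => f (embedUnitary V * M)) _).symm

end Haar

/-! ### The distribution of a cascade -/

section CascadeLaw

variable {N : ℕ} {O : (K : ℕ) → (Fin K → ℝ) → Matrix (Fin K) (Fin K) ℝ}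

instance (G : (n : Fin N) → LabelledTree n.val) : IsProbabilityMeasure (paramMeasure G) := by
  unfold paramMeasure; infer_instance

instance : IsProbabilityMeasure (haarMatrixLaw N) :=
  Measure.isProbabilityMeasure_map measurable_subtype_coe.aemeasurable

/-- The version of `haarU_succ` for laws of matrices. The rotation of arbitrary real parameters need
not be unitary, so the law lives on matrices and is unitary only almost surely; `comap` brings it to
the group. -/
theorem haarMatrixLaw_succ (ρ : Measure (Matrix (Fin (N + 1)) (Fin (N + 1)) ℂ))
    [IsProbabilityMeasure ρ] (hU : ∀ᵐ U ∂ρ, U ∈ Matrix.unitaryGroup (Fin (N + 1)) ℂ)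
    (hρ : ∀ W : Matrix.unitaryGroup (Fin (N + 1)) ℂ,
      (ρ.map fun U i => U (Fin.last N) i).map (fun v => Matrix.vecMul v W.1) =
        ρ.map fun U i => U (Fin.last N) i) :
    ((haarMatrixLaw N).prod ρ).map (fun z => embed Fin.castSuccEmb z.1 * z.2) =
      haarMatrixLaw (N + 1) := by
  set ρ' : Measure (Matrix.unitaryGroup (Fin (N + 1)) ℂ) := ρ.comap Subtype.val with hρ'
  have h1 : ρ'.map Subtype.val = ρ := by
    refine ((MeasurableEmbedding.subtype_coe measurableSet_unitaryGroup).map_comap ρ).trans ?_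
    rw [Subtype.range_coe]
    exact Measure.restrict_eq_self_of_ae_mem hU
  have h2 : IsProbabilityMeasure ρ' := by
    constructor
    have := congrArg (fun μ => μ Set.univ) h1
    simpa [Measure.map_apply measurable_subtype_coe MeasurableSet.univ] using this
  have h3 : ρ'.map lastRow = ρ.map fun U i => U (Fin.last N) i := by
    conv_rhs => rw [← h1]
    rw [Measure.map_map measurable_last_row measurable_subtype_coe]
    rfl
  have h4 := haarU_succ ρ' (by rw [h3]; exact hρ)
  rw [haarMatrixLaw, haarMatrixLaw, ← h4, ← h1, Measure.map_prod_map _ _ measurable_subtype_coe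
    measurable_subtype_coe, Measure.map_map, Measure.map_map]
  · rfl
  · exact measurable_subtype_coe
  · exact (measurable_embedUnitary.comp measurable_fst).mul measurable_snd
  · exact measurable_matrix_mul ((measurable_embed _).comp measurable_fst) measurable_snd
  · exact measurable_subtype_coe.prodMap measurable_subtype_coe

theorem eq_of_subsingleton_of_isProbabilityMeasure {X : Type*} [MeasurableSpace X] [Subsingleton X]
    (μ ν : Measure X) [IsProbabilityMeasure μ] [IsProbabilityMeasure ν] : μ = ν := by
  ext s _
  rcases s.eq_empty_or_nonempty with rfl | hs
  · simp
  · rw [Subsingleton.eq_univ_of_nonempty hs, measure_univ, measure_univ]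

theorem paramMeasure_split (G : (n : Fin (N + 1)) → LabelledTree n.val) :
    (paramMeasure G).map (fun p => (initParams p, p (Fin.last N))) =
      (paramMeasure (initTrees G)).prod (rotationMeasure (lastTree G)) :=
  pi_map_snoc fun n => rotationMeasure (G n)

theorem paramMeasure_map_cascade (G : (n : Fin N) → LabelledTree n.val)
    (hO : ∀ (n : Fin N) (j : (G n).tree.Node), IsNodeOperator (O ((G n).tree.extra j + 2))) :
    (paramMeasure G).map (cascade G O) = haarMatrixLaw N := by
  induction N with
  | zero =>
    -- For `N = 0` there is a single matrix, hence a single probability measure.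
    have := Measure.isProbabilityMeasure_map (μ := paramMeasure G)
      (measurable_cascade G hO).aemeasurable
    exact eq_of_subsingleton_of_isProbabilityMeasure _ _
  | succ N ih =>
    have hR := measurable_rotation (lastTree G) (hO (Fin.last N))
    have hC := measurable_cascade (initTrees G) fun n => hO n.castSucc
    have hsplit : Measurable fun p : Params G => (initParams p, p (Fin.last N)) :=
      (measurable_pi_iff.2 fun n => measurable_pi_apply n.castSucc).prodMk (measurable_pi_apply _)
    have hae := rotationMeasure_ae_mem (lastTree G)
    have hprob := Measure.isProbabilityMeasure_map (μ := rotationMeasure (lastTree G))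
      hR.aemeasurable
    have hrow : ((rotationMeasure (lastTree G)).map fun p => rotation (lastTree G) O p.1 p.2).map
        (fun U i => U (Fin.last N) i) = (rotationMeasure (lastTree G)).map (rowVec (lastTree G)) := by
      rw [Measure.map_map measurable_last_row hR]
      refine Measure.map_congr ?_
      filter_upwards [hae] with p hp
      exact rotation_last (lastTree G) (hO (Fin.last N)) _ fun j => (hp.2 j).2
    rw [← haarMatrixLaw_succ ((rotationMeasure (lastTree G)).map
        fun p => rotation (lastTree G) O p.1 p.2), ← ih (initTrees G) fun n => hO n.castSucc,
      Measure.map_prod_map _ _ hC hR, ← paramMeasure_split, Measure.map_map (hC.prodMap hR) hsplit,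
      Measure.map_map]
    · exact congrArg (fun f => (paramMeasure G).map f) (funext fun p => cascade_succ G p)
    · exact measurable_matrix_mul ((measurable_embed _).comp measurable_fst) measurable_snd
    · exact (hC.prodMap hR).comp hsplit
    · refine (ae_map_iff hR.aemeasurable measurableSet_unitaryGroup).2 ?_
      filter_upwards [hae] with p hp
      exact rotation_mem_unitary (lastTree G) (hO (Fin.last N)) _ fun j => (hp.2 j).2
    · intro W
      rw [hrow]
      exact (rowLaw_vecMul (lastTree G) W.2).map_eq

theorem paramMeasure_ae_regular (G : (n : Fin N) → LabelledTree n.val) :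
    ∀ᵐ p ∂paramMeasure G, p ∈ regular G := by
  have h : ∀ᵐ p ∂paramMeasure G, ∀ n, (∀ i, (p n).1 i ∈ Set.Ico 0 (2 * Real.pi)) ∧
      ∀ j, (∀ k, 0 < (p n).2 j k) ∧ (p n).2 j ∈ stdSimplex ℝ (Fin ((G n).tree.extra j + 2)) := by
    rw [ae_all_iff]
    intro n
    exact (measurePreserving_eval (fun n => rotationMeasure (G n)) n).quasiMeasurePreserving.ae
      (rotationMeasure_ae_mem (G n))
  filter_upwards [h] with p hp
  exact ⟨fun n => ⟨(hp n).1, fun j => ((hp n).2 j).2⟩, fun n j k => ((hp n).2 j).1 k⟩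

end CascadeLaw

/-! ### Beta distributions -/

section Beta

open ProbabilityTheory

theorem measurable_betaPDF (a b : ℝ) : Measurable (betaPDF a b) :=
  (measurable_betaPDFReal a b).ennreal_ofReal

/-- At a node of a binary tree, `extra` is only propositionally zero. A variable `e` with `e = 0`
allows the substitution in the types. -/
theorem betaMeasure_map_dirichlet {e : ℕ} (he : e = 0) {α : Fin (e + 2) → ℝ} (hα : ∀ k, 0 < α k) :
    MeasurePreserving (fun (t : ℝ) (k : Fin (e + 2)) => if k = 0 then t else 1 - t)
      (betaMeasure (α 0) (α (Fin.last _))) (dirichletMeasure α) := by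
  subst he
  have hm : Measurable fun (t : ℝ) (k : Fin (0 + 2)) => if k = 0 then t else 1 - t := by
    refine measurable_pi_iff.2 fun k => ?_
    split_ifs <;> fun_prop
  refine ⟨hm, Measure.ext_of_lintegral _ fun f hf => ?_⟩
  have hd : Measurable fun x : Fin (0 + 1) → ℝ => ENNReal.ofReal (dirichletPDF α (completeSimplex x)) :=
    ((measurable_dirichletPDF α).comp measurable_completeSimplex).ennreal_ofReal
  have hfc : Measurable fun x : Fin (0 + 1) → ℝ => f (completeSimplex x) :=
    hf.comp measurable_completeSimplex
  have hfm : Measurable fun t : ℝ => f fun k : Fin (0 + 2) => if k = 0 then t else 1 - t :=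
    hf.comp hm
  rw [lintegral_map hf hm, betaMeasure, lintegral_withDensity_eq_lintegral_mul _
    (measurable_betaPDF _ _) hfm, dirichletMeasure, lintegral_map hf measurable_completeSimplex,
    lintegral_withDensity_eq_lintegral_mul _ hd hfc, ← lintegral_indicator measurableSet_openSimplex]
  have hvol := (volume_preserving_funUnique (Fin 1) ℝ).symm
  refine Eq.trans ?_ (hvol.lintegral_comp ((hd.mul hfc).indicator measurableSet_openSimplex))
  refine lintegral_congr fun t => ?_
  have hcs : completeSimplex ((MeasurableEquiv.funUnique (Fin 1) ℝ).symm t) =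
      fun k : Fin (0 + 2) => if k = 0 then t else 1 - t := by
    funext k
    fin_cases k
    · rfl
    · change 1 - ∑ i : Fin 1, t = 1 - t
      simp
  by_cases ht : 0 < t ∧ t < 1
  · rw [Set.indicator_of_mem]
    · rw [Pi.mul_apply, Pi.mul_apply, hcs, betaPDF_of_pos_lt_one ht.1 ht.2]
      congr 2
      rw [dirichletPDF, Fin.sum_univ_two, Fin.prod_univ_two, Fin.prod_univ_two,
        ProbabilityTheory.beta]
      change 1 / (Real.Gamma (α 0) * Real.Gamma (α 1) / Real.Gamma (α 0 + α 1)) *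
        t ^ (α 0 - 1) * (1 - t) ^ (α 1 - 1) = Real.Gamma (α 0 + α 1) /
          (Real.Gamma (α 0) * Real.Gamma (α 1)) * (t ^ (α 0 - 1) * (1 - t) ^ (α 1 - 1))
      rw [one_div_div, mul_assoc]
    · refine (completeSimplex_pos_iff _).1 ?_
      rw [hcs]
      intro k
      dsimp only
      split_ifs
      · exact ht.1
      · linarith [ht.2]
  · rw [Set.indicator_of_notMem, Pi.mul_apply, betaPDF_eq, if_neg ht, ENNReal.ofReal_zero, zero_mul]
    intro h
    have h2 := (completeSimplex_pos_iff _).2 h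
    rw [hcs] at h2
    have h3 := h2 0
    have h4 := h2 1
    simp at h3 h4
    exact ht ⟨h3, h4⟩

theorem lintegral_betaMeasure (a b : ℝ) {f : ℝ → ℝ≥0∞} (hf : Measurable f) :
    ∫⁻ t, f t ∂betaMeasure a b = ∫⁻ t in Set.Ioo (0 : ℝ) 1,
      ENNReal.ofReal (t ^ (a - 1) * (1 - t) ^ (b - 1) / ProbabilityTheory.beta a b) * f t := by
  rw [betaMeasure, lintegral_withDensity_eq_lintegral_mul _
    (measurable_betaPDF a b) hf, ← lintegral_indicator measurableSet_Ioo]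
  refine lintegral_congr fun t => ?_
  by_cases ht : t ∈ Set.Ioo (0 : ℝ) 1
  · rw [Set.indicator_of_mem ht, Pi.mul_apply, betaPDF, betaPDFReal, if_pos (Set.mem_Ioo.1 ht)]
    congr 2
    ring
  · rw [Set.indicator_of_notMem ht, Pi.mul_apply, betaPDF, betaPDFReal, if_neg fun h' => ht (Set.mem_Ioo.2 h')]
    simp

theorem betaMeasure_ae_mem (a b : ℝ) : ∀ᵐ t ∂betaMeasure a b, t ∈ Set.Ioo (0 : ℝ) 1 := by
  rw [betaMeasure, ae_withDensity_iff (measurable_betaPDF a b)]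
  refine ae_of_all _ fun t ht => ?_
  by_contra h
  exact ht (by rw [betaPDF, betaPDFReal, if_neg fun h' => h (Set.mem_Ioo.2 h'), ENNReal.ofReal_zero])

theorem cos_half_pos {θ : ℝ} (hθ : θ ∈ Set.Ioo 0 Real.pi) : 0 < Real.cos (θ / 2) :=
  Real.cos_pos_of_mem_Ioo ⟨by linarith [hθ.1, Real.pi_pos], by linarith [hθ.2]⟩

theorem sin_half_pos {θ : ℝ} (hθ : θ ∈ Set.Ioo 0 Real.pi) : 0 < Real.sin (θ / 2) :=
  Real.sin_pos_of_pos_of_lt_pi (by linarith [hθ.1]) (by linarith [hθ.1, hθ.2])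

theorem cos_half_sq_image : (fun θ => Real.cos (θ / 2) ^ 2) '' Set.Ioo 0 Real.pi =
    Set.Ioo 0 1 := by
  ext t
  constructor
  · rintro ⟨θ, hθ, rfl⟩
    have h1 : 0 < Real.cos (θ / 2) := cos_half_pos hθ
    have h2 : 0 < Real.sin (θ / 2) := sin_half_pos hθ
    have h3 := Real.sin_sq_add_cos_sq (θ / 2)
    exact ⟨by positivity, by nlinarith⟩
  · rintro ⟨h0, h1⟩
    refine ⟨2 * Real.arccos √t, ⟨?_, ?_⟩, ?_⟩
    · have : 0 < Real.arccos √t := Real.arccos_pos.2 (by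
        rw [Real.sqrt_lt' one_pos]; simpa using h1)
      linarith
    · have : Real.arccos √t < Real.pi / 2 := Real.arccos_lt_pi_div_two.2 (Real.sqrt_pos.2 h0)
      linarith
    · change Real.cos (2 * Real.arccos √t / 2) ^ 2 = t
      rw [mul_div_cancel_left₀ _ two_ne_zero, Real.cos_arccos (by linarith [Real.sqrt_nonneg t])
        (Real.sqrt_le_one.2 h1.le), Real.sq_sqrt h0.le]

/-- Substitution `t = cos² (θ / 2)`, with `|dt/dθ| = cos (θ / 2) sin (θ / 2)`. This extra factor
raises the exponents `2 a - 2` and `2 b - 2` by one. -/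
theorem phaseBeta_map_betaMeasure {a b : ℝ} (ha : 0 < a) (hb : 0 < b) :
    MeasurePreserving (fun θ => Real.cos (θ / 2) ^ 2) (phaseBetaMeasure a b) (betaMeasure a b) := by
  have hm : Measurable fun θ : ℝ => Real.cos (θ / 2) ^ 2 := by fun_prop
  refine ⟨hm, Measure.ext_of_lintegral _ fun f hf => ?_⟩
  have hdens : Measurable fun θ : ℝ => ENNReal.ofReal (Real.cos (θ / 2) ^ (2 * a - 1) *
      Real.sin (θ / 2) ^ (2 * b - 1) / ProbabilityTheory.beta a b) := by fun_prop
  have hfm : Measurable fun θ : ℝ => f (Real.cos (θ / 2) ^ 2) := hf.comp hm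
  have hderiv : ∀ θ ∈ Set.Ioo 0 Real.pi, HasDerivWithinAt (fun θ => Real.cos (θ / 2) ^ 2)
      (-(Real.cos (θ / 2) * Real.sin (θ / 2))) (Set.Ioo 0 Real.pi) θ := by
    intro θ _
    have h := (((hasDerivAt_id θ).div_const 2).cos.pow 2).hasDerivWithinAt (s := Set.Ioo 0 Real.pi)
    refine HasDerivWithinAt.congr_deriv (f := fun θ => Real.cos (θ / 2) ^ 2) h ?_
    simp
    ring
  have hinj : Set.InjOn (fun θ => Real.cos (θ / 2) ^ 2) (Set.Ioo 0 Real.pi) := by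
    intro x hx y hy h
    have hx1 : 0 < Real.cos (x / 2) := cos_half_pos hx
    have hy1 : 0 < Real.cos (y / 2) := cos_half_pos hy
    have h2 := (sq_eq_sq₀ hx1.le hy1.le).1 h
    have h3 := Real.injOn_cos ⟨by linarith [hx.1], by linarith [hx.1, hx.2]⟩
      ⟨by linarith [hy.1], by linarith [hy.1, hy.2]⟩ h2
    linarith
  rw [lintegral_map hf hm, phaseBetaMeasure, lintegral_withDensity_eq_lintegral_mul _ hdens hfm,
    lintegral_betaMeasure a b hf, ← cos_half_sq_image,
    lintegral_image_eq_lintegral_abs_deriv_mul measurableSet_Ioo hderiv hinj]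
  refine setLIntegral_congr_fun measurableSet_Ioo fun θ hθ => ?_
  have hc : 0 < Real.cos (θ / 2) := cos_half_pos hθ
  have hs : 0 < Real.sin (θ / 2) := sin_half_pos hθ
  have hB := beta_pos ha hb
  have h1 : 1 - Real.cos (θ / 2) ^ 2 = Real.sin (θ / 2) ^ 2 := by
    have := Real.sin_sq_add_cos_sq (θ / 2); linarith
  have hpow : ∀ {x : ℝ} (c : ℝ), 0 < x → x * (x ^ 2) ^ (c - 1) = x ^ (2 * c - 1) := by
    intro x c hx
    rw [← Real.rpow_natCast, ← Real.rpow_mul hx.le]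
    nth_rewrite 1 [← Real.rpow_one x]
    rw [← Real.rpow_add hx]
    congr 1
    push_cast
    ring
  simp only [Pi.mul_apply]
  rw [h1, abs_neg, abs_of_pos (mul_pos hc hs), ← mul_assoc, ← ENNReal.ofReal_mul (by positivity),
    ← hpow a hc, ← hpow b hs]
  congr 2
  ring

theorem isProbabilityMeasure_phaseBeta {a b : ℝ} (ha : 0 < a) (hb : 0 < b) :
    IsProbabilityMeasure (phaseBetaMeasure a b) := by
  have := isProbabilityMeasureBeta ha hb
  have h := (phaseBeta_map_betaMeasure ha hb).measure_preimage MeasurableSet.univ.nullMeasurableSet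
  exact ⟨by simpa using h⟩

/-! ### The regularized incomplete beta function -/

variable {a b : ℝ}

/-- With `a, b ≥ 1`, which holds for leaf counts, the real powers are continuous on all of `ℝ`. The
incomplete beta function is then differentiable everywhere, endpoints included. -/
theorem continuous_betaIntegrand (ha : 1 ≤ a) (hb : 1 ≤ b) :
    Continuous fun u : ℝ => u ^ (a - 1) * (1 - u) ^ (b - 1) :=
  (Real.continuous_rpow_const (by linarith)).mul
    ((Real.continuous_rpow_const (by linarith)).comp (by fun_prop))

theorem hasDerivAt_regBeta (ha : 1 ≤ a) (hb : 1 ≤ b) (t : ℝ) :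
    HasDerivAt (regBeta a b) (t ^ (a - 1) * (1 - t) ^ (b - 1) / ProbabilityTheory.beta a b) t :=
  ((continuous_betaIntegrand ha hb).integral_hasStrictDerivAt 0 t).hasDerivAt.div_const _

theorem continuous_regBeta (ha : 1 ≤ a) (hb : 1 ≤ b) : Continuous (regBeta a b) :=
  continuous_iff_continuousAt.2 fun t => (hasDerivAt_regBeta ha hb t).continuousAt

theorem regBeta_zero : regBeta a b 0 = 0 := by simp [regBeta]

/-- This is the total mass of the beta distribution. -/
theorem regBeta_one (ha : 1 ≤ a) (hb : 1 ≤ b) : regBeta a b 1 = 1 := by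
  have hB := beta_pos (lt_of_lt_of_le one_pos ha) (lt_of_lt_of_le one_pos hb)
  have := isProbabilityMeasureBeta (lt_of_lt_of_le one_pos ha) (lt_of_lt_of_le one_pos hb)
  have h := lintegral_betaMeasure a b (f := fun _ => 1) measurable_const
  simp only [lintegral_one, measure_univ, mul_one] at h
  rw [regBeta, intervalIntegral.integral_of_le zero_le_one, integral_Ioc_eq_integral_Ioo,
    ← integral_div, integral_eq_lintegral_of_nonneg_ae, ← h, ENNReal.toReal_one]
  · filter_upwards [ae_restrict_mem measurableSet_Ioo] with t ht
    have h1 : 0 < t := ht.1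
    have h2 : 0 < 1 - t := by linarith [ht.2]
    simp only [Pi.zero_apply]
    positivity
  · exact ((continuous_betaIntegrand ha hb).div_const _).aestronglyMeasurable

theorem strictMonoOn_regBeta (ha : 1 ≤ a) (hb : 1 ≤ b) :
    StrictMonoOn (regBeta a b) (Set.Icc 0 1) := by
  refine strictMonoOn_of_deriv_pos (convex_Icc 0 1) (continuous_regBeta ha hb).continuousOn ?_
  intro t ht
  rw [interior_Icc] at ht
  have hB := beta_pos (lt_of_lt_of_le one_pos ha) (lt_of_lt_of_le one_pos hb)
  have h1 : 0 < t := ht.1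
  have h2 : 0 < 1 - t := by linarith [ht.2]
  rw [(hasDerivAt_regBeta ha hb t).deriv]
  positivity

theorem regBeta_bijOn (ha : 1 ≤ a) (hb : 1 ≤ b) :
    Set.BijOn (regBeta a b) (Set.Icc 0 1) (Set.Icc 0 1) := by
  have hmono := strictMonoOn_regBeta ha hb
  have h0 : (0 : ℝ) ∈ Set.Icc (0 : ℝ) 1 := ⟨le_rfl, zero_le_one⟩
  have h1 : (1 : ℝ) ∈ Set.Icc (0 : ℝ) 1 := ⟨zero_le_one, le_rfl⟩
  refine ⟨fun t ht => ⟨?_, ?_⟩, hmono.injOn, ?_⟩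
  · rw [← regBeta_zero (a := a) (b := b)]
    exact hmono.monotoneOn h0 ht ht.1
  · rw [← regBeta_one ha hb]
    exact hmono.monotoneOn ht h1 ht.2
  · have := intermediate_value_Icc zero_le_one (continuous_regBeta ha hb).continuousOn
    rwa [regBeta_zero, regBeta_one ha hb] at this

theorem regBeta_image_Ioo (ha : 1 ≤ a) (hb : 1 ≤ b) :
    regBeta a b '' Set.Ioo 0 1 = Set.Ioo 0 1 := by
  have hmono := strictMonoOn_regBeta ha hb
  have h0 : (0 : ℝ) ∈ Set.Icc (0 : ℝ) 1 := ⟨le_rfl, zero_le_one⟩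
  have h1 : (1 : ℝ) ∈ Set.Icc (0 : ℝ) 1 := ⟨zero_le_one, le_rfl⟩
  ext s
  constructor
  · rintro ⟨t, ht, rfl⟩
    have h2 := hmono h0 (Set.Ioo_subset_Icc_self ht) ht.1
    have h3 := hmono (Set.Ioo_subset_Icc_self ht) h1 ht.2
    rw [regBeta_zero] at h2
    rw [regBeta_one ha hb] at h3
    exact ⟨h2, h3⟩
  · intro hs
    obtain ⟨t, ht, rfl⟩ := (regBeta_bijOn ha hb).surjOn (Set.Ioo_subset_Icc_self hs)
    refine ⟨t, ⟨lt_of_le_of_ne ht.1 ?_, lt_of_le_of_ne ht.2 ?_⟩, rfl⟩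
    · rintro rfl
      exact hs.1.ne regBeta_zero.symm
    · rintro rfl
      exact hs.2.ne (regBeta_one ha hb)

/-- The derivative of `regBeta` is the beta density, so the substitution `ξ = I_t(a, b)` leaves
Lebesgue measure. -/
theorem regBeta_map_betaMeasure (ha : 1 ≤ a) (hb : 1 ≤ b) :
    MeasurePreserving (regBeta a b) (betaMeasure a b)
      ((volume : Measure ℝ).restrict (Set.Icc 0 1)) := by
  have hm := (continuous_regBeta ha hb).measurable
  have hB := beta_pos (lt_of_lt_of_le one_pos ha) (lt_of_lt_of_le one_pos hb)
  refine ⟨hm, Measure.ext_of_lintegral _ fun f hf => ?_⟩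
  have hinj : Set.InjOn (regBeta a b) (Set.Ioo 0 1) :=
    (strictMonoOn_regBeta ha hb).injOn.mono Set.Ioo_subset_Icc_self
  have h := lintegral_image_eq_lintegral_abs_deriv_mul measurableSet_Ioo
    (fun t _ => (hasDerivAt_regBeta ha hb t).hasDerivWithinAt) hinj f
  rw [regBeta_image_Ioo ha hb] at h
  have hfm : Measurable fun t => f (regBeta a b t) := hf.comp hm
  rw [lintegral_map hf hm, lintegral_betaMeasure a b hfm, ← setLIntegral_congr Ioo_ae_eq_Icc,
    h]
  refine setLIntegral_congr_fun measurableSet_Ioo fun t ht => ?_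
  have h1 : 0 < t := ht.1
  have h2 : 0 < 1 - t := by linarith [ht.2]
  rw [abs_of_pos (by positivity)]

theorem regBetaInv_regBeta (ha : 1 ≤ a) (hb : 1 ≤ b) {t : ℝ} (ht : t ∈ Set.Icc (0 : ℝ) 1) :
    regBetaInv a b (regBeta a b t) = t :=
  (regBeta_bijOn ha hb).injOn.leftInvOn_invFunOn ht

/-- On `[0, 1]` the inverse of an increasing function is monotone; elsewhere `Function.invFunOn`
returns one fixed default value. -/
theorem measurable_regBetaInv (ha : 1 ≤ a) (hb : 1 ≤ b) : Measurable (regBetaInv a b) := by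
  refine measurable_of_restrict_of_restrict_compl 
    (measurableSet_Icc : MeasurableSet (Set.Icc (0 : ℝ) 1)) ?_ ?_
  · have hmono : Monotone fun x : Set.Icc (0 : ℝ) 1 => regBetaInv a b x := ?_
    · have h := hmono.measurable
      exact h
    rintro ⟨x, hx⟩ ⟨y, hy⟩ hxy
    have hx' := Function.invFunOn_pos ((regBeta_bijOn ha hb).surjOn hx)
    have hy' := Function.invFunOn_pos ((regBeta_bijOn ha hb).surjOn hy)
    change regBetaInv a b x ≤ regBetaInv a b y
    refine ((strictMonoOn_regBeta ha hb).le_iff_le hx'.1 hy'.1).1 ?_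
    rw [hx'.2, hy'.2]
    exact hxy
  · have : ∀ x : ((Set.Icc (0 : ℝ) 1)ᶜ : Set ℝ), regBetaInv a b x = Classical.choice inferInstance := by
      rintro ⟨x, hx⟩
      refine Function.invFunOn_neg ?_
      rintro ⟨t, ht, rfl⟩
      exact hx ((regBeta_bijOn ha hb).mapsTo ht)
    exact (measurable_const' fun x y => (this x).trans (this y).symm)

theorem regBetaInv_map_uniform (ha : 1 ≤ a) (hb : 1 ≤ b) :
    MeasurePreserving (regBetaInv a b) ((volume : Measure ℝ).restrict (Set.Icc 0 1))
      (betaMeasure a b) := by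
  refine ⟨measurable_regBetaInv ha hb, ?_⟩
  rw [← (regBeta_map_betaMeasure ha hb).map_eq,
    Measure.map_map (measurable_regBetaInv ha hb) (continuous_regBeta ha hb).measurable]
  conv_rhs => rw [← Measure.map_id (μ := betaMeasure a b)]
  refine Measure.map_congr ?_
  filter_upwards [betaMeasure_ae_mem a b] with t ht
  exact regBetaInv_regBeta ha hb (Set.Ioo_subset_Icc_self ht)

theorem regBeta_natCast_one {w : ℕ} (hw : 0 < w) (t : ℝ) : regBeta w 1 t = t ^ w := by
  have hw' : (0 : ℝ) < w := Nat.cast_pos.2 hw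
  have h1 : ∀ u : ℝ, u ^ ((w : ℝ) - 1) * (1 - u) ^ ((1 : ℝ) - 1) = u ^ (w - 1) := by
    intro u
    rw [sub_self, Real.rpow_zero, mul_one, ← Nat.cast_pred hw, Real.rpow_natCast]
  have h2 : ProbabilityTheory.beta w 1 = 1 / w := by
    rw [ProbabilityTheory.beta, Real.Gamma_one, Real.Gamma_add_one hw'.ne', mul_one, div_mul_eq_div_div_swap,
      div_self (Real.Gamma_pos_of_pos hw').ne']
  rw [regBeta, h2]
  simp only [h1]
  rw [integral_pow, Nat.sub_add_cancel hw, Nat.cast_pred hw]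
  simp [hw.ne']

end Beta

/-! ### Binary trees -/

theorem isBinary_child {k : ℕ} {c : Fin (k + 2) → DTree} (h : (DTree.node k c).IsBinary)
    (i : Fin (k + 2)) : (c i).IsBinary :=
  fun j => h (Sum.inr ⟨i, j⟩)

/-- A root with two subtrees adds one node, while the leaves of the subtrees exceed their nodes by
two in total. -/
theorem card_leaf_of_isBinary (t : DTree) (h : t.IsBinary) :
    Fintype.card t.Leaf = Fintype.card t.Node + 1 := by
  induction t with
  | leaf => rfl
  | node k c ih =>
    obtain rfl : k = 0 := h (Sum.inl ())
    have h1 : Fintype.card (DTree.node 0 c).Leaf = ∑ i, Fintype.card (c i).Leaf :=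
      Fintype.card_sigma (α := fun i => (c i).Leaf)
    have h2 : Fintype.card (DTree.node 0 c).Node = 1 + ∑ i, Fintype.card (c i).Node := by
      refine (Fintype.card_sum (α := Unit) (β := Σ i, (c i).Node)).trans ?_
      rw [Fintype.card_sigma, Fintype.card_unit]
    have h3 := fun i => ih i (isBinary_child h i)
    rw [h1, h2]
    simp only [h3]
    rw [Finset.sum_add_distrib, Finset.sum_const, Finset.card_univ, Fintype.card_fin]
    ring

theorem card_leaf_labelledTree {m : ℕ} (G : LabelledTree m) : Fintype.card G.tree.Leaf = m + 1 := by
  rw [Fintype.card_congr G.input, Fintype.card_fin]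

theorem one_le_alpha {m : ℕ} (G : LabelledTree m) (j : G.tree.Node) : 1 ≤ alpha G j :=
  Nat.one_le_cast.2 (weight_pos _ _ _)

theorem one_le_beta {m : ℕ} (G : LabelledTree m) (j : G.tree.Node) : 1 ≤ beta G j :=
  Nat.one_le_cast.2 (weight_pos _ _ _)

theorem alpha_pos {m : ℕ} (G : LabelledTree m) (j : G.tree.Node) : 0 < alpha G j :=
  zero_lt_one.trans_le (one_le_alpha G j)

theorem beta_pos {m : ℕ} (G : LabelledTree m) (j : G.tree.Node) : 0 < beta G j :=
  zero_lt_one.trans_le (one_le_beta G j)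

instance {m : ℕ} (G : LabelledTree m) (j : G.tree.Node) :
    IsProbabilityMeasure (ProbabilityTheory.betaMeasure (alpha G j) (beta G j)) :=
  ProbabilityTheory.isProbabilityMeasureBeta (alpha_pos G j) (beta_pos G j)

instance {m : ℕ} (G : LabelledTree m) (j : G.tree.Node) :
    IsProbabilityMeasure (phaseBetaMeasure (alpha G j) (beta G j)) :=
  isProbabilityMeasure_phaseBeta (alpha_pos G j) (beta_pos G j)

section Binary

variable {N : ℕ} (G : (n : Fin N) → LabelledTree n.val)

theorem mapNodes_measurePreserving {f : (n : Fin N) → (G n).tree.Node → ℝ → ℝ}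
    {ν ν' : (n : Fin N) → (G n).tree.Node → Measure ℝ} [∀ n j, IsProbabilityMeasure (ν n j)]
    [∀ n j, IsProbabilityMeasure (ν' n j)]
    (h : ∀ n j, MeasurePreserving (f n j) (ν n j) (ν' n j)) :
    MeasurePreserving (mapNodes f) (binMeasure G ν) (binMeasure G ν') :=
  measurePreserving_pi _ _ fun n =>
    (MeasurePreserving.id (Measure.pi fun _ : Fin (n.val + 1) => phaseMeasure)).prod
      (measurePreserving_pi (ν n) (ν' n) (h n))

theorem ofTransmissivity_measurePreserving (hG : ∀ n, (G n).tree.IsBinary) :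
    MeasurePreserving (ofTransmissivity G)
      (binMeasure G fun n j => ProbabilityTheory.betaMeasure (alpha (G n) j) (beta (G n) j))
      (paramMeasure G) := by
  have h : ∀ n j, MeasurePreserving
      (fun (t : ℝ) (k : Fin ((G n).tree.extra j + 2)) => if k = 0 then t else 1 - t)
      (ProbabilityTheory.betaMeasure (alpha (G n) j) (beta (G n) j))
      (dirichletMeasure fun k => ((G n).tree.weight j k : ℝ)) := fun n j =>
    betaMeasure_map_dirichlet (α := fun k => ((G n).tree.weight j k : ℝ)) (hG n j)
      (weight_cast_pos (G n).tree j)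
  have h1 := fun n => (MeasurePreserving.id
    (Measure.pi fun _ : Fin (n.val + 1) => phaseMeasure)).prod (measurePreserving_pi
      (fun j => ProbabilityTheory.betaMeasure (alpha (G n) j) (beta (G n) j))
      (fun j => dirichletMeasure fun k => ((G n).tree.weight j k : ℝ)) (h n))
  exact measurePreserving_pi
    (fun n : Fin N => (Measure.pi fun _ : Fin (n.val + 1) => phaseMeasure).prod
      (Measure.pi fun j => ProbabilityTheory.betaMeasure (alpha (G n) j) (beta (G n) j)))
    (fun n : Fin N => (Measure.pi fun _ : Fin (n.val + 1) => phaseMeasure).prod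
      (Measure.pi fun j => dirichletMeasure fun k => ((G n).tree.weight j k : ℝ))) h1

theorem sum_ite_eq_zero_one_sub {e : ℕ} (he : e = 0) (t : ℝ) :
    (∑ k : Fin (e + 2), if k = 0 then t else 1 - t) = 1 := by
  subst he
  simp

theorem ofTransmissivity_mem_regular (hG : ∀ n, (G n).tree.IsBinary) {q : BinParams G}
    (hq : q ∈ binRegular G) : ofTransmissivity G q ∈ regular G := by
  have hpos : ∀ n j k, 0 < (ofTransmissivity G q n).2 j k := by
    intro n j k
    have := (hq n).2 j
    simp only [ofTransmissivity]
    split_ifs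
    · exact this.1
    · linarith [this.2]
  refine ⟨fun n => ⟨(hq n).1, fun j => ⟨fun k => (hpos n j k).le, ?_⟩⟩, hpos⟩
  exact sum_ite_eq_zero_one_sub (hG n j) _

theorem ofTransmissivity_injective : Function.Injective (ofTransmissivity G) := by
  intro q r h
  funext n
  have h1 := congrFun h n
  have h0 := congrArg Prod.fst h1
  refine Prod.ext h0 (funext fun j => ?_)
  have h2 := congrFun (congrFun (congrArg Prod.snd h1) j) 0
  simpa [ofTransmissivity] using h2

theorem measurableSet_binRegular : MeasurableSet (binRegular G) := by
  have h : binRegular G = Set.univ.pi fun n => (Set.univ.pi fun _ => Set.Ico 0 (2 * Real.pi)) ×ˢ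
      (Set.univ.pi fun _ => Set.Ioo (0 : ℝ) 1) := by
    ext q
    simp [binRegular, Set.mem_pi]
  rw [h]
  exact MeasurableSet.univ_pi fun n => (MeasurableSet.univ_pi fun _ => measurableSet_Ico).prod
    (MeasurableSet.univ_pi fun _ => measurableSet_Ioo)

theorem binMeasure_ae_binRegular {ν : (n : Fin N) → (G n).tree.Node → Measure ℝ}
    [∀ n j, IsProbabilityMeasure (ν n j)] (h : ∀ n j, ∀ᵐ t ∂ν n j, t ∈ Set.Ioo (0 : ℝ) 1) :
    ∀ᵐ q ∂binMeasure G ν, q ∈ binRegular G := by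
  change ∀ᵐ q ∂binMeasure G ν, ∀ n, _
  rw [ae_all_iff]
  intro n
  have h1 : ∀ᵐ φ ∂(Measure.pi fun _ : Fin (n.val + 1) => phaseMeasure),
      ∀ i, φ i ∈ Set.Ico 0 (2 * Real.pi) := by
    rw [ae_all_iff]
    intro i
    exact (measurePreserving_eval _ i).quasiMeasurePreserving.ae phaseMeasure_ae_mem
  have h2 : ∀ᵐ t ∂(Measure.pi (ν n)), ∀ j, t j ∈ Set.Ioo (0 : ℝ) 1 := by
    rw [ae_all_iff]
    intro j
    exact (measurePreserving_eval _ j).quasiMeasurePreserving.ae (h n j)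
  have h3 : ∀ᵐ p ∂((Measure.pi fun _ : Fin (n.val + 1) => phaseMeasure).prod (Measure.pi (ν n))),
      (∀ i, p.1 i ∈ Set.Ico 0 (2 * Real.pi)) ∧ ∀ j, p.2 j ∈ Set.Ioo (0 : ℝ) 1 := by
    filter_upwards [Measure.quasiMeasurePreserving_fst.ae h1,
      Measure.quasiMeasurePreserving_snd.ae h2] with p hp hp'
    exact ⟨hp, hp'⟩
  exact (measurePreserving_eval (fun n : Fin N => (Measure.pi fun _ : Fin (n.val + 1) =>
    phaseMeasure).prod (Measure.pi (ν n))) n).quasiMeasurePreserving.ae h3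

end Binary

/-- By Lusin–Souslin, `f '' (A ∩ B)` is measurable. Its preimage meets `B` in `A ∩ B` because `f` is
injective there, so the image law gives the measure of `A`. -/
theorem measure_eq_of_map_eq_of_injOn {X Z : Type*} [MeasurableSpace X] [StandardBorelSpace X]
    [MeasurableSpace Z] [MeasurableSpace.CountablySeparated Z] {f : X → Z} (hf : Measurable f)
    {B : Set X} (hB : MeasurableSet B) (hinj : Set.InjOn f B) {μ ν : Measure X}
    (hμ : ∀ᵐ x ∂μ, x ∈ B) (hν : ∀ᵐ x ∂ν, x ∈ B) (h : μ.map f = ν.map f) : μ = ν := by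
  have key : ∀ ρ : Measure X, (∀ᵐ x ∂ρ, x ∈ B) → ∀ A, MeasurableSet A →
      ρ A = ρ.map f (f '' (A ∩ B)) := by
    intro ρ hρ A hA
    rw [Measure.map_apply hf ((hA.inter hB).image_of_measurable_injOn hf
      (hinj.mono Set.inter_subset_right))]
    refine measure_congr ?_
    filter_upwards [hρ] with x hx
    refine propext ⟨fun hxA => ⟨x, ⟨hxA, hx⟩, rfl⟩, ?_⟩
    rintro ⟨y, ⟨hyA, hyB⟩, hyx⟩
    have := hinj hyB hx hyx
    exact this ▸ hyA
  ext A hA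
  rw [key μ hμ A hA, key ν hν A hA, h]

/-! ### Unbalanced trees -/

theorem card_leaf_chain (m : ℕ) : Fintype.card (DTree.chain m).Leaf = m + 1 := by
  induction m with
  | zero => rfl
  | succ m ih =>
    refine (Fintype.card_sigma (α := fun i => ((![DTree.chain m, DTree.leaf] :
      Fin 2 → DTree) i).Leaf)).trans ?_
    rw [Fin.sum_univ_two]
    change Fintype.card (DTree.chain m).Leaf + 1 = _
    rw [ih]

theorem weight_chain_last (m : ℕ) (j : (DTree.chain m).Node) :
    (DTree.chain m).weight j (Fin.last _) = 1 := by
  induction m with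
  | zero => exact j.elim
  | succ m ih =>
    rcases j with ⟨⟩ | ⟨i, j⟩
    · rfl
    · induction i using Fin.cases with
      | zero => exact ih j
      | succ i =>
        obtain rfl := Subsingleton.elim i 0
        exact Empty.elim j

/-- The root of the chain with `m + 1` nodes has weight `m + 1` at its first edge, and all nodes
below stay within `m`. This gap also separates the root from the rest in `weight_chain_injective`.
-/
theorem weight_chain_mem (m : ℕ) (j : (DTree.chain m).Node) :
    (DTree.chain m).weight j 0 ∈ Set.Icc 1 m := by
  induction m with
  | zero => exact j.elim
  | succ m ih =>
    rcases j with ⟨⟩ | ⟨i, j⟩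
    · have h : (DTree.chain (m + 1)).weight (Sum.inl ()) 0 = m + 1 := card_leaf_chain m
      exact ⟨by rw [h]; omega, h.le⟩
    · induction i using Fin.cases with
      | zero =>
        have := ih j
        exact ⟨this.1, this.2.trans (Nat.le_succ m)⟩
      | succ i =>
        obtain rfl := Subsingleton.elim i 0
        exact Empty.elim j

theorem weight_chain_injective (m : ℕ) :
    Function.Injective fun j : (DTree.chain m).Node => (DTree.chain m).weight j 0 := by
  induction m with
  | zero => exact fun j => j.elim
  | succ m ih =>
    have h0 : (DTree.chain (m + 1)).weight (Sum.inl ()) 0 = m + 1 := card_leaf_chain m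
    have h1 : ∀ j : (DTree.chain m).Node,
        (DTree.chain (m + 1)).weight (Sum.inr ⟨0, j⟩) 0 = (DTree.chain m).weight j 0 := fun _ => rfl
    have h2 : ∀ j : (DTree.chain (m + 1)).Node, j = Sum.inl () ∨
        ∃ j' : (DTree.chain m).Node, j = Sum.inr ⟨0, j'⟩ := by
      rintro (⟨⟩ | ⟨i, j⟩)
      · exact Or.inl rfl
      · induction i using Fin.cases with
        | zero => exact Or.inr ⟨j, rfl⟩
        | succ i =>
          obtain rfl := Subsingleton.elim i 0
          exact Empty.elim j
    intro j j' h
    dsimp only at h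
    rcases h2 j with rfl | ⟨i, rfl⟩ <;> rcases h2 j' with rfl | ⟨i', rfl⟩
    · rfl
    · rw [h0, h1] at h
      have := (weight_chain_mem m i').2
      omega
    · rw [h0, h1] at h
      have := (weight_chain_mem m i).2
      omega
    · rw [h1, h1] at h
      rw [ih h]

theorem weight_chain_surjOn (m : ℕ) :
    Set.SurjOn (fun j : (DTree.chain m).Node => (DTree.chain m).weight j 0) Set.univ
      (Set.Icc 1 m) := by
  induction m with
  | zero =>
    intro w hw
    have := hw.1.trans hw.2
    omega
  | succ m ih =>
    intro w hw
    rcases hw.2.eq_or_lt with rfl | h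
    · exact ⟨Sum.inl (), trivial, card_leaf_chain m⟩
    · obtain ⟨j, -, hj⟩ := ih ⟨hw.1, Nat.lt_succ_iff.1 h⟩
      exact ⟨Sum.inr ⟨0, j⟩, trivial, hj⟩

theorem weight_of_eq_chain {m : ℕ} {t : DTree} (ht : t = DTree.chain m) :
    Set.BijOn (fun j => t.weight j 0) Set.univ (Set.Icc 1 m) ∧
      ∀ j, t.weight j (Fin.last _) = 1 := by
  subst ht
  exact ⟨⟨fun j _ => weight_chain_mem m j, (weight_chain_injective m).injOn, weight_chain_surjOn m⟩,
    weight_chain_last m⟩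

end TreeHaar

/-! ### The main theorem -/

open TreeHaar in
theorem mainTheorem6 (N : ℕ) (G : (n : Fin N) → LabelledTree n.val)
    (O : (K : ℕ) → (Fin K → ℝ) → Matrix (Fin K) (Fin K) ℝ)
    (hO : ∀ (n : Fin N) (j : (G n).tree.Node), IsNodeOperator (O ((G n).tree.extra j + 2))) :
    -- the cascades are exactly the unitary matrices, with almost everywhere unique parameters
    cascade G O '' admissible G = {U | U ∈ Matrix.unitaryGroup (Fin N) ℂ} ∧
    Set.InjOn (cascade G O) (regular G) ∧
    (∀ᵐ p ∂paramMeasure G, p ∈ regular G) ∧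
    -- the Haar measure is the product of uniform phases and Dirichlet distributions
    (paramMeasure G).map (cascade G O) = haarMatrixLaw N ∧
    -- binary trees
    ((∀ n, (G n).tree.IsBinary) →
      (∀ n : Fin N, Fintype.card (G n).tree.Node = n.val) ∧
      -- transmissivities
      (binMeasure G fun n j => ProbabilityTheory.betaMeasure (alpha (G n) j) (beta (G n) j)).map
        (fun q => cascade G O (ofTransmissivity G q)) = haarMatrixLaw N ∧
      -- angles, with `t = cos² (θ / 2)`
      (binMeasure G fun n j => phaseBetaMeasure (alpha (G n) j) (beta (G n) j)).map
        (fun q => cascade G O (ofTransmissivity G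
          (mapNodes (fun _ _ θ => Real.cos (θ / 2) ^ 2) q))) = haarMatrixLaw N ∧
      -- Haar phases `ξ = I_t(α, β)`
      (∀ (n : Fin N) (j : (G n).tree.Node),
        Set.BijOn (regBeta (alpha (G n) j) (beta (G n) j)) (Set.Icc 0 1) (Set.Icc 0 1)) ∧
      (binMeasure G fun n j => ProbabilityTheory.betaMeasure (alpha (G n) j) (beta (G n) j)).map
        (mapNodes fun n j => regBeta (alpha (G n) j) (beta (G n) j)) =
          (binMeasure G fun _ _ => volume.restrict (Set.Icc 0 1)) ∧
      (binMeasure G fun _ _ => volume.restrict (Set.Icc 0 1)).map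
        (fun q => cascade G O (ofTransmissivity G
          (mapNodes (fun n j => regBetaInv (alpha (G n) j) (beta (G n) j)) q))) =
            haarMatrixLaw N ∧
      (∀ Q : Measure (BinParams G), IsProbabilityMeasure Q → (∀ᵐ q ∂Q, q ∈ binRegular G) →
        (Q.map (fun q => cascade G O (ofTransmissivity G q)) = haarMatrixLaw N ↔
          Q.map (mapNodes fun n j => regBeta (alpha (G n) j) (beta (G n) j)) =
            (binMeasure G fun _ _ => volume.restrict (Set.Icc 0 1))))) ∧
    -- the maximally unbalanced binary trees
    (∀ n : Fin N, (G n).tree = DTree.chain n.val →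
      Set.BijOn (fun j => (G n).tree.weight j 0) Set.univ (Set.Icc 1 n.val) ∧
      ∀ j : (G n).tree.Node, beta (G n) j = 1 ∧
        ∀ t ∈ Set.Icc (0 : ℝ) 1,
          regBeta (alpha (G n) j) (beta (G n) j) t = t ^ ((G n).tree.weight j 0)) := by
  have hC : MeasurePreserving (cascade G O) (paramMeasure G) (haarMatrixLaw N) :=
    ⟨measurable_cascade G hO, paramMeasure_map_cascade G hO⟩
  refine ⟨?_, cascade_injOn G hO, paramMeasure_ae_regular G, hC.map_eq, fun hG => ?_,
    fun n hn => ?_⟩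
  · ext U
    constructor
    · rintro ⟨p, hp, rfl⟩
      exact cascade_mem_unitary G hO hp
    · intro hU
      exact cascade_surjective G hO hU
  · have : IsProbabilityMeasure ((volume : Measure ℝ).restrict (Set.Icc 0 1)) := ⟨by simp⟩
    have hT := hC.comp (ofTransmissivity_measurePreserving G hG)
    have hθ := mapNodes_measurePreserving G (f := fun _ _ θ => Real.cos (θ / 2) ^ 2)
      fun n j => phaseBeta_map_betaMeasure (alpha_pos (G n) j) (beta_pos (G n) j)
    have hξ := mapNodes_measurePreserving G
      fun n j => regBeta_map_betaMeasure (one_le_alpha (G n) j) (one_le_beta (G n) j)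
    have hinv := mapNodes_measurePreserving G
      fun n j => regBetaInv_map_uniform (one_le_alpha (G n) j) (one_le_beta (G n) j)
    refine ⟨fun n => ?_, hT.map_eq, (hT.comp hθ).map_eq,
      fun n j => regBeta_bijOn (one_le_alpha (G n) j) (one_le_beta (G n) j), hξ.map_eq,
      (hT.comp hinv).map_eq, fun Q _ hQ => ⟨fun h => ?_, fun h => ?_⟩⟩
    · have h1 := card_leaf_of_isBinary _ (hG n)
      rw [card_leaf_labelledTree] at h1
      omega
    -- `Q` and the product of beta distributions are both carried by `binRegular G`, on which the
    -- cascade is injective, and both have Haar image.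
    · have hQ' : Q = binMeasure G fun n j =>
          ProbabilityTheory.betaMeasure (alpha (G n) j) (beta (G n) j) := by
        refine measure_eq_of_map_eq_of_injOn hT.measurable (measurableSet_binRegular G) ?_ hQ
          (binMeasure_ae_binRegular G fun n j => betaMeasure_ae_mem _ _) (h.trans hT.map_eq.symm)
        intro q hq r hr hqr
        exact ofTransmissivity_injective G (cascade_injOn G hO
          (ofTransmissivity_mem_regular G hG hq) (ofTransmissivity_mem_regular G hG hr) hqr)
      rw [hQ', hξ.map_eq]
    · have hQ' : Q = binMeasure G fun n j =>
          ProbabilityTheory.betaMeasure (alpha (G n) j) (beta (G n) j) := by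
        -- Undoing the Haar phases recovers `Q`: almost surely the transmissivities lie in `(0, 1)`,
        -- where `regBetaInv` is a left inverse of `regBeta`.
        rw [← hinv.map_eq, ← h, Measure.map_map hinv.measurable hξ.measurable]
        conv_lhs => rw [← Measure.map_id (μ := Q)]
        refine Measure.map_congr ?_
        filter_upwards [hQ] with q hq
        funext n
        refine Prod.ext rfl (funext fun j => ?_)
        exact (regBetaInv_regBeta (one_le_alpha (G n) j) (one_le_beta (G n) j)
          (Set.Ioo_subset_Icc_self ((hq n).2 j))).symm
      rw [hQ']
      exact hT.map_eq
  · obtain ⟨hbij, hlast⟩ := weight_of_eq_chain hn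
    refine ⟨hbij, fun j => ?_⟩
    have hβ : beta (G n) j = 1 := by rw [beta, hlast j, Nat.cast_one]
    refine ⟨hβ, fun t _ => ?_⟩
    rw [hβ]
    exact regBeta_natCast_one (weight_pos _ _ _) t
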